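/- A network consists of $N=\sum_{l=1}^L N_l$ sensors, where sensor $(k,l)$, $1\le k\le N_l$, $1\le l\le L$, is of type $l$. For each type $l$ let $f_l,g_l$ be probability distributions with Kullback–Leibler divergence $\mathcal I_l=D(g_l\|f_l)\in(0,\infty)$. Under $P_0$ (the change occurs at time $0$) the observations $X_t^{k,l}$, $t=1,2,\dots$, are independent over all times and sensors, with $X_t^{k,l}\sim g_l$. Let $Z_t^{k,l}=\log\frac{dg_l}{df_l}(X_t^{k,l})$ be the log-likelihood ratios and let $$W_0^{k,l}=0,\qquad W_t^{k,l}=\max\{0,W_{t-1}^{k,l}\}+Z_t^{k,l}$$ be the local CUSUM statistics. For a threshold vector $\mathbf h=(h_1,\dots,h_L)$ and $1\le M\le N$ define the $M$-th alarm rule and the $M$ voting rule by $$\rho^{(M)}(\mathbf h)=\inf\Big\{t:\big|\{(k,l):\max_{s\le t}W_s^{k,l}>h_l\}\big|\ge M\Big\},\qquad \rho_M(\mathbf h)=\inf\Big\{t:\big|\{(k,l):W_t^{k,l}>h_l\}\big|\ge M\Big\}.$$ Theorem. Let $\mathbf h=(\mathcal I_1h,\dots,\mathcal I_Lh)$ and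 assume that $\sigma_l^2=E_0[(Z_t^{k,l}-\mathcal I_l)^2]<\infty$ for all $l$. Let $\xi_M$ be the expectation of the $M$-th order statistic ($M$-th smallest value) of independent Gaussian random variables $G_{k,l}\sim N(0,\sigma_l^2/\mathcal I_l^2)$, $1\le k\le N_l$, $1\le l\le L$. Then, as $h\to\infty$, the expectations below are finite for all large $h$ and $$E_0[\rho^{(M)}(\mathbf h)]=h+(\xi_M+o(1))\sqrt h,\qquad E_0[\rho_M(\mathbf h)]\le h+(\xi_M+o(1))\sqrt h .$$ For $\xi_M\neq0$ this is the same as $h+\xi_M\sqrt h\,(1+o(1))$. -/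

import Mathlib

open MeasureTheory ProbabilityTheory InformationTheory Filter Topology
open scoped ENNReal NNReal

namespace HetQCD

noncomputable section

/-- The sensors of a network with `L` types and `N l` sensors of type `l`:
the pair `⟨l, k⟩` is the `k`-th sensor of type `l`. -/
abbrev Sensor {L : ℕ} (N : Fin L → ℕ) : Type := (l : Fin L) × Fin (N l)

/-- Under the probability measure `P`, the observations follow the change-point model with change
time `ν` (`ν = ⊤` if there is no change). Observations are made at the times `1, 2, 3, …`, and
`X n s` is the observation of sensor `s` at time `n + 1`. All observations, over all times and all
sensors, are independent; at time `t` a sensor of type `l` observes a variable with law `f l`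
if `t ≤ ν` and with law `g l` if `t > ν`. -/
structure IsChangeModel {L : ℕ} {N : Fin L → ℕ} {Ω : Type*} [MeasurableSpace Ω]
    {E : Fin L → Type*} [∀ l, MeasurableSpace (E l)] (f g : (l : Fin L) → Measure (E l))
    (ν : ℕ∞) (P : Measure Ω) (X : ℕ → (s : Sensor N) → Ω → E s.1) : Prop where
  measurable : ∀ n s, Measurable (X n s)
  indep : iIndepFun (fun (p : ℕ × Sensor N) => X p.1 p.2) P
  law_pre : ∀ n s, ((n + 1 : ℕ) : ℕ∞) ≤ ν → P.map (X n s) = f s.1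
  law_post : ∀ n s, ν < ((n + 1 : ℕ) : ℕ∞) → P.map (X n s) = g s.1

/-- The Kullback–Leibler divergence `D(g ‖ f)` as a real number. -/
def info {E : Type*} [MeasurableSpace E] (f g : Measure E) : ℝ := (klDiv g f).toReal

/-- The second moment `σ²` of `Z - D(g ‖ f)` for the log-likelihood ratio
`Z = log (dg/df)(X)` with `X` of law `g`, possibly infinite. -/
def llrVar {E : Type*} [MeasurableSpace E] (f g : Measure E) : ℝ≥0∞ :=
  ∫⁻ x, ENNReal.ofReal ((llr g f x - info f g) ^ 2) ∂g

/-- The CUSUM statistic at time `t` driven by increments `Z`, where `Z n` is the increment at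
time `n + 1`: `W_0 = 0` and `W_t = max {0, W_{t-1}} + Z_t`. -/
def cusum (Z : ℕ → ℝ) : ℕ → ℝ
  | 0 => 0
  | t + 1 => max 0 (cusum Z t) + Z t

/-- The local CUSUM statistic `W_t` of sensor `s`, driven by its log-likelihood ratios. -/
def localCusum {L : ℕ} {N : Fin L → ℕ} {Ω : Type*} {E : Fin L → Type*}
    [∀ l, MeasurableSpace (E l)] (f g : (l : Fin L) → Measure (E l))
    (X : ℕ → (s : Sensor N) → Ω → E s.1) (s : Sensor N) (ω : Ω) : ℕ → ℝ :=
  cusum fun n => llr (g s.1) (f s.1) (X n s ω)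

/-- The `M`-th alarm rule with thresholds `h`: the first time `t` such that at least `M` sensors
have `max_{u ≤ t} W_u > h_l`; it is `⊤` if there is no such time. -/
def alarmTime {L : ℕ} {N : Fin L → ℕ} {Ω : Type*} {E : Fin L → Type*}
    [∀ l, MeasurableSpace (E l)] (f g : (l : Fin L) → Measure (E l))
    (X : ℕ → (s : Sensor N) → Ω → E s.1) (M : ℕ) (h : Fin L → ℝ) (ω : Ω) : ℕ∞ :=
  ⨅ (t : ℕ) (_ : M ≤ {s : Sensor N | partialSups (localCusum f g X s ω) t > h s.1}.ncard),
    (t : ℕ∞)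

/-- The `M` voting rule with thresholds `h`: the first time `t` such that at least `M` sensors
have `W_t > h_l` simultaneously; it is `⊤` if there is no such time. -/
def votingTime {L : ℕ} {N : Fin L → ℕ} {Ω : Type*} {E : Fin L → Type*}
    [∀ l, MeasurableSpace (E l)] (f g : (l : Fin L) → Measure (E l))
    (X : ℕ → (s : Sensor N) → Ω → E s.1) (M : ℕ) (h : Fin L → ℝ) (ω : Ω) : ℕ∞ :=
  ⨅ (t : ℕ) (_ : M ≤ {s : Sensor N | localCusum f g X s ω t > h s.1}.ncard), (t : ℕ∞)

/-- The `M`-th order statistic (`M`-th smallest value, with multiplicity) of a finite family of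
reals, `1 ≤ M ≤ card ι`: the least `y` such that at least `M` members of the family are `≤ y`. -/
def orderStat {ι : Type*} (M : ℕ) (x : ι → ℝ) : ℝ :=
  sInf {y : ℝ | M ≤ {i : ι | x i ≤ y}.ncard}

/-- `ξ_M`: the expectation of the `M`-th order statistic of independent Gaussian variables
`G_s ∼ N(0, σ_l² / I_l²)`, one for every sensor `s` (of type `l`). -/
def xi {L : ℕ} (N : Fin L → ℕ) {E : Fin L → Type*} [∀ l, MeasurableSpace (E l)]
    (f g : (l : Fin L) → Measure (E l)) (M : ℕ) : ℝ :=
  ∫ x : Sensor N → ℝ, orderStat M x ∂(Measure.pi fun s : Sensor N =>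
    gaussianReal 0 ((llrVar (f s.1) (g s.1)).toNNReal / (info (f s.1) (g s.1)).toNNReal ^ 2))

end

end HetQCD

/-! Write the mean of a stopping time as the sum over `n` of its survival probabilities and look at
`n = ⌊h + x √h⌋`. A single CUSUM statistic lies between its random walk, of drift `m`, and its own
running maximum. The gap between these two is `o(√n)` in probability, so the central limit theorem
for the walk gives P(level `m h` exceeded at time `n`) → P(G ≤ x), for G ∼ N(0, v/m²), whether the
statistic or its running maximum is used (`tendsto_prob_lt`).

The sensors are independent, so the probability that at least `M` of them are above their levels is
one fixed polynomial, `countProb`, in the single-sensor probabilities. The same polynomial gives the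
distribution function of the `M`-th order statistic (`prob_lt_orderStat`). Hence the survival
profile converges to the tail of the Gaussian order statistic. Subtracting the indicator of `(0, h]`
and substituting `t = h + x √h` turns the sum into `h + √h ∫ (profile - 1_{x ≤ 0}) dx`, and
dominated convergence identifies the limit of the integral as the mean of the order statistic
(`tsum_expansion`, `integral_eq_integral_tail`).

The dominating function is `C / x²`. Kolmogorov's and Chebyshev's inequalities provide it for `n ≤
4h`. Beyond `4h` one application of Chebyshev decays only like `1/n`, so two independent blocks of
increments are used to get `1/n²` (`prob_forall_notMem_voteSet_le`). Alarm events increase in time,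
which gives equality; voting events need not, and survival is then only bounded by the absence of a
vote at time `n`. Means take values in `ℝ≥0∞`, so comparison with `ENNReal.ofReal` includes
finiteness. -/

namespace HetQCD

/-! ### CUSUM statistics as maxima of increments of the walk -/

section Cusum

/-- The recursion restarts from `0` whenever that is better, so it dominates the walk restarted at
any earlier time. The case `j = t` is excluded because the statistic itself may be negative. -/
lemma sum_sub_sum_le_cusum (Z : ℕ → ℝ) {j t : ℕ} (hjt : j < t) :
    ∑ i ∈ Finset.range t, Z i - ∑ i ∈ Finset.range j, Z i ≤ cusum Z t := by
  induction t with
  | zero => omega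
  | succ t ih =>
    rw [Finset.sum_range_succ, cusum]
    rcases Nat.lt_succ_iff_lt_or_eq.mp hjt with h | rfl
    · linarith [ih h, le_max_right 0 (cusum Z t)]
    · linarith [le_max_left 0 (cusum Z j)]

lemma sum_le_cusum (Z : ℕ → ℝ) (t : ℕ) : ∑ i ∈ Finset.range t, Z i ≤ cusum Z t := by
  rcases t.eq_zero_or_pos with rfl | h
  · simp [cusum]
  · simpa using sum_sub_sum_le_cusum Z h

/-- The witness `j` is the last restart. -/
lemma exists_cusum_le (Z : ℕ → ℝ) (t : ℕ) :
    ∃ j ≤ t, cusum Z t ≤ ∑ i ∈ Finset.range t, Z i - ∑ i ∈ Finset.range j, Z i := by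
  induction t with
  | zero => exact ⟨0, le_rfl, by simp [cusum]⟩
  | succ t ih =>
    obtain ⟨j, hj, h⟩ := ih
    rcases le_total (cusum Z t) 0 with h0 | h0
    · exact ⟨t, t.le_succ, by rw [cusum, max_eq_left h0, Finset.sum_range_succ]; linarith⟩
    · exact ⟨j, by omega, by rw [cusum, max_eq_right h0, Finset.sum_range_succ]; linarith⟩

lemma exists_partialSups_cusum_le (Z : ℕ → ℝ) (t : ℕ) :
    ∃ u ≤ t, ∃ j ≤ u, partialSups (cusum Z) t ≤
      ∑ i ∈ Finset.range u, Z i - ∑ i ∈ Finset.range j, Z i := by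
  obtain ⟨u, hu, h⟩ := exists_partialSups_eq (cusum Z) t
  obtain ⟨j, hj, hj'⟩ := exists_cusum_le Z u
  exact ⟨u, hu, j, hj, h ▸ hj'⟩

lemma measurable_cusum (t : ℕ) : Measurable fun Z : ℕ → ℝ => cusum Z t := by
  induction t with
  | zero => exact measurable_const
  | succ t ih => exact (measurable_const.max ih).add (measurable_pi_apply t)

lemma measurable_partialSups_cusum (t : ℕ) :
    Measurable fun Z : ℕ → ℝ => partialSups (cusum Z) t := by
  simp_rw [partialSups_eq_sup'_range]
  exact Finset.measurable_range_sup'' (f := fun k (Z : ℕ → ℝ) => cusum Z k)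
    fun k _ => measurable_cusum k

end Cusum

/-! ### Independence of blocks and of rows -/

section Independence

variable {Ω : Type*} [MeasurableSpace Ω] {P : Measure Ω}

/-- Padding with zeros lets `F` and `G` live on the full product instead of on products over
subtypes. -/
lemma indepFun_of_disjoint {ι : Type*} [DecidableEq ι] {Y : ι → Ω → ℝ} (hY : iIndepFun Y P)
    (hm : ∀ i, Measurable (Y i)) {S T : Finset ι} (hST : Disjoint S T)
    {α β : Type*} [MeasurableSpace α] [MeasurableSpace β]
    {F : (ι → ℝ) → α} {G : (ι → ℝ) → β} (hF : Measurable F) (hG : Measurable G) :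
    IndepFun (fun ω => F fun i => if i ∈ S then Y i ω else 0)
      (fun ω => G fun i => if i ∈ T then Y i ω else 0) P := by
  have key := hY.indepFun_finset S T hST hm
  let e (S : Finset ι) (y : S → ℝ) (i : ι) : ℝ := if h : i ∈ S then y ⟨i, h⟩ else 0
  have he (S : Finset ι) : Measurable (e S) := by
    refine measurable_pi_lambda _ fun i => ?_
    by_cases h : i ∈ S
    · simpa [e, h] using measurable_pi_apply _
    · simp [e, h]
  have := key.comp (hF.comp (he S)) (hG.comp (he T))
  simpa [e, Function.comp_def] using this

/-- The rows of an independent array are independent. -/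
lemma iIndepFun_rows {ι : Type*} {Y : ℕ × ι → Ω → ℝ} (hY : iIndepFun Y P)
    (hm : ∀ p, Measurable (Y p)) : iIndepFun (fun s ω n => Y (n, s) ω) P := by
  have := hY.isProbabilityMeasure
  have inj : Function.Injective fun p : (_ : ι) × ℕ => (p.2, p.1) := by
    rintro ⟨a, b⟩ ⟨c, d⟩ h; simp_all
  have h1 : iIndepFun (fun p : (_ : ι) × ℕ => Y (p.2, p.1)) P := hY.precomp inj
  have h2 (s : ι) : iIndepFun (fun n => Y (n, s)) P :=
    hY.precomp (g := fun n => (n, s)) fun a b h => by simpa using h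
  have (s : ι) (n : ℕ) : IsProbabilityMeasure (P.map (Y (n, s))) :=
    Measure.isProbabilityMeasure_map (hm _).aemeasurable
  rw [iIndepFun_iff_map_fun_eq_infinitePi_map (by fun_prop)]
  have e : (MeasurableEquiv.piCurry fun (_ : ι) (_ : ℕ) => ℝ) ∘
      (fun ω (p : (_ : ι) × ℕ) => Y (p.2, p.1) ω) = fun ω s n => Y (n, s) ω := by
    ext; simp [Sigma.curry]
  rw [← e, ← Measure.map_map (by fun_prop) (by fun_prop),
    (iIndepFun_iff_map_fun_eq_infinitePi_map (by fun_prop)).1 h1]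
  have := Measure.infinitePi_map_piCurry (fun (s : ι) (n : ℕ) => P.map (Y (n, s)))
  rw [this]
  congrm Measure.infinitePi fun s => ?_
  rw [(iIndepFun_iff_map_fun_eq_infinitePi_map (by fun_prop)).1 (h2 s)]

end Independence

/-! ### Kolmogorov's maximal inequality -/

section Kolmogorov

variable {Ω : Type*} [MeasurableSpace Ω] {P : Measure Ω}

lemma integral_sq_sum [IsProbabilityMeasure P] {Y : ℕ → Ω → ℝ} (hind : iIndepFun Y P)
    (hL2 : ∀ i, MemLp (Y i) 2 P) (h0 : ∀ i, ∫ ω, Y i ω ∂P = 0) {v : ℝ}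
    (hv : ∀ i, Var[Y i; P] = v) (s : Finset ℕ) :
    ∫ ω, (∑ i ∈ s, Y i ω) ^ 2 ∂P = s.card * v := by
  have hm : ∫ ω, (∑ i ∈ s, Y i) ω ∂P = 0 := by
    simp only [Finset.sum_apply]
    rw [integral_finsetSum _ fun i _ => (hL2 i).integrable one_le_two]
    simp [h0]
  have h1 := IndepFun.variance_sum (s := s) (fun i _ => hL2 i)
    (fun i _ j _ hij => hind.indepFun hij)
  rw [variance_of_integral_eq_zero (memLp_finsetSum' s fun i _ => hL2 i).1.aemeasurable hm] at h1
  simpa [hv] using h1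

/-- Kolmogorov's maximal inequality. -/
theorem kolmogorov_maximal [IsProbabilityMeasure P] {Y : ℕ → Ω → ℝ} (hind : iIndepFun Y P)
    (hmeas : ∀ i, Measurable (Y i)) (hL2 : ∀ i, MemLp (Y i) 2 P)
    (h0 : ∀ i, ∫ ω, Y i ω ∂P = 0) {v : ℝ} (hv : ∀ i, Var[Y i; P] = v) (n : ℕ) {a : ℝ}
    (ha : 0 < a) :
    P.real {ω | ∃ k ≤ n, a ≤ |∑ i ∈ Finset.range k, Y i ω|} ≤ n * v / a ^ 2 := by
  classical
  set T : ℕ → Ω → ℝ := fun k ω => ∑ i ∈ Finset.range k, Y i ω with hT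
  have hTm (k : ℕ) : Measurable (T k) := Finset.measurable_sum _ fun i _ => hmeas i
  have hTL (k : ℕ) : MemLp (T k) 2 P := memLp_finsetSum _ fun i _ => hL2 i
  -- Decomposition by first passage: on `A k` the level `a` is reached first at time `k`.
  set A : ℕ → Set Ω := fun k => {ω | a ≤ |T k ω| ∧ ∀ j < k, |T j ω| < a} with hA
  have hAm (k : ℕ) : MeasurableSet (A k) := by
    have e : A k = {ω | a ≤ |T k ω|} ∩ ⋂ j, ⋂ (_ : j < k), {ω | |T j ω| < a} := by
      ext; simp [hA]
    rw [e]
    refine (measurableSet_le measurable_const (hTm k).abs).inter ?_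
    exact MeasurableSet.iInter fun j => MeasurableSet.iInter fun _ =>
      measurableSet_lt (hTm j).abs measurable_const
  have hAdisj : Pairwise (Function.onFun Disjoint A) := by
    refine (pairwise_disjoint_on A).2 fun i j hij => Set.disjoint_left.2 fun ω h1 h2 => ?_
    exact absurd (h2.2 i hij) (not_lt.2 h1.1)
  have hU : {ω | ∃ k ≤ n, a ≤ |T k ω|} = ⋃ k ∈ Finset.range (n + 1), A k := by
    ext ω
    simp only [Set.mem_ofPred_eq, Set.mem_iUnion, Finset.mem_range, exists_prop, hA]
    constructor
    · intro h
      obtain ⟨h1, h2⟩ := Nat.find_spec h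
      refine ⟨Nat.find h, by omega, h2, fun j hj => ?_⟩
      have := Nat.find_min h hj
      push Not at this
      exact this (by omega)
    · rintro ⟨k, hk, h1, -⟩
      exact ⟨k, by omega, h1⟩
  have hTsq : Integrable (fun ω => T n ω ^ 2) P := (hTL n).integrable_sq
  -- The first factor depends only on the increments before `k`, the second only on those from `k`
  -- on, and the latter has mean zero.
  have hcross (k : ℕ) (hk : k ≤ n) :
      ∫ ω, (A k).indicator (T k) ω * (T n ω - T k ω) ∂P = 0 := by
    let F : (ℕ → ℝ) → ℝ := fun y =>
      if (a ≤ |∑ i ∈ Finset.range k, y i| ∧ ∀ j < k, |∑ i ∈ Finset.range j, y i| < a) then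
        ∑ i ∈ Finset.range k, y i else 0
    let G : (ℕ → ℝ) → ℝ := fun y => ∑ i ∈ Finset.Ico k n, y i
    have hsm (s : Finset ℕ) : Measurable fun y : ℕ → ℝ => ∑ i ∈ s, y i :=
      Finset.measurable_sum _ fun i _ => measurable_pi_apply i
    have hF : Measurable F := by
      refine Measurable.ite ?_ (hsm _) measurable_const
      have e : {y : ℕ → ℝ | a ≤ |∑ i ∈ Finset.range k, y i| ∧
          ∀ j < k, |∑ i ∈ Finset.range j, y i| < a} =
          {y | a ≤ |∑ i ∈ Finset.range k, y i|} ∩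
            ⋂ j, ⋂ (_ : j < k), {y | |∑ i ∈ Finset.range j, y i| < a} := by
        ext; simp
      rw [e]
      refine (measurableSet_le measurable_const (hsm _).abs).inter ?_
      exact MeasurableSet.iInter fun j => MeasurableSet.iInter fun _ =>
        measurableSet_lt (hsm _).abs measurable_const
    have hdisj : Disjoint (Finset.range k) (Finset.Ico k n) := by
      rw [Finset.range_eq_Ico]; exact Finset.Ico_disjoint_Ico_consecutive 0 k n
    have hi := indepFun_of_disjoint hind hmeas hdisj hF (hsm (Finset.Ico k n))
    have e1 : (fun ω => F fun i => if i ∈ Finset.range k then Y i ω else 0) =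
        (A k).indicator (T k) := by
      ext ω
      have hs (j : ℕ) (hj : j ≤ k) :
          ∑ i ∈ Finset.range j, (if i ∈ Finset.range k then Y i ω else 0) = T j ω :=
        Finset.sum_congr rfl fun i hi => by
          simp only [Finset.mem_range] at hi ⊢; rw [if_pos (by omega)]
      have h2 : (∀ j < k, |∑ i ∈ Finset.range j, (if i ∈ Finset.range k then Y i ω else 0)| < a) ↔
          ∀ j < k, |T j ω| < a :=
        forall₂_congr fun j hj => by rw [hs j hj.le]
      simp only [F, hs k le_rfl, h2, Set.indicator_apply, hA, Set.mem_ofPred_eq]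
    have e2 : (fun ω => ∑ i ∈ Finset.Ico k n, if i ∈ Finset.Ico k n then Y i ω else 0) =
        fun ω => T n ω - T k ω := by
      ext ω
      rw [hT, ← Finset.sum_Ico_eq_sub _ hk]
      exact Finset.sum_congr rfl fun i hi => if_pos hi
    rw [e1, e2] at hi
    rw [hi.integral_fun_mul_eq_mul_integral ((hTm k).indicator (hAm k)).aestronglyMeasurable
      ((hTm n).sub (hTm k)).aestronglyMeasurable]
    have z (m : ℕ) : ∫ ω, T m ω ∂P = 0 := by
      rw [hT, integral_finsetSum _ fun i _ => (hL2 i).integrable one_le_two]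
      simp [h0]
    rw [integral_sub ((hTL n).integrable one_le_two) ((hTL k).integrable one_le_two), z, z]
    simp
  have hstep (k : ℕ) (hk : k ≤ n) : a ^ 2 * P.real (A k) ≤ ∫ ω in A k, T n ω ^ 2 ∂P := by
    have hc := hcross k hk
    have hint : Integrable (fun ω => (A k).indicator (T k) ω * (T n ω - T k ω)) P :=
      ((hTL k).indicator (hAm k)).integrable_mul ((hTL n).sub (hTL k))
    -- On `A k`, `T n² ≥ T k² + 2 T k (T n - T k)` and `T k² ≥ a²`; the cross term integrates to
    -- zero.
    have hle : ∫ ω, ((A k).indicator (fun _ => a ^ 2) ω +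
        2 * ((A k).indicator (T k) ω * (T n ω - T k ω))) ∂P ≤
        ∫ ω, (A k).indicator (fun ω => T n ω ^ 2) ω ∂P := by
      refine integral_mono (((integrable_const _).indicator (hAm k)).add (hint.const_mul 2))
        (hTsq.indicator (hAm k)) fun ω => ?_
      by_cases hω : ω ∈ A k
      · simp only [hω, Set.indicator_of_mem]
        have h1 : a ^ 2 ≤ T k ω ^ 2 := by
          rw [← sq_abs (T k ω)]; exact pow_le_pow_left₀ ha.le hω.1 2
        nlinarith [sq_nonneg (T n ω - T k ω)]
      · simp [hω]
    rw [integral_add ((integrable_const _).indicator (hAm k)) (hint.const_mul 2),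
      integral_const_mul, hc, integral_indicator (hAm k), integral_indicator (hAm k)] at hle
    simp only [integral_const, MeasurableSet.univ, measureReal_restrict_apply, Set.univ_inter,
      smul_eq_mul, mul_zero, add_zero] at hle
    linarith
  have hfin : a ^ 2 * P.real {ω | ∃ k ≤ n, a ≤ |T k ω|} ≤ n * v := by
    rw [hU, measureReal_biUnion_finset (fun i _ j _ hij => hAdisj hij) fun k _ => hAm k,
      Finset.mul_sum]
    calc _ ≤ ∑ k ∈ Finset.range (n + 1), ∫ ω in A k, T n ω ^ 2 ∂P :=
          Finset.sum_le_sum fun k hk => hstep k (by simp at hk; omega)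
      _ = ∫ ω in ⋃ k ∈ Finset.range (n + 1), A k, T n ω ^ 2 ∂P :=
          (integral_biUnion_finset _ (fun k _ => hAm k) (fun i _ j _ hij => hAdisj hij)
            fun k _ => hTsq.integrableOn).symm
      _ ≤ ∫ ω, T n ω ^ 2 ∂P :=
          setIntegral_le_integral hTsq (Eventually.of_forall fun ω => sq_nonneg _)
      _ = n * v := by
          rw [hT, integral_sq_sum hind hL2 h0 hv]; simp
  rw [le_div_iff₀ (by positivity)]
  linarith

end Kolmogorov

/-! ### Deviation bounds for a walk with positive drift -/

/-- `Z` is an i.i.d. sequence of square-integrable variables with mean `m > 0` and variance `v`. -/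
structure IsDriftWalk {Ω : Type*} [MeasurableSpace Ω] (P : Measure Ω) (Z : ℕ → Ω → ℝ)
    (m v : ℝ) : Prop where
  measurable : ∀ n, Measurable (Z n)
  indep : iIndepFun Z P
  ident : ∀ n, IdentDistrib (Z n) (Z 0) P P
  memLp : MemLp (Z 0) 2 P
  mean : ∫ ω, Z 0 ω ∂P = m
  variance : Var[Z 0; P] = v
  drift_pos : 0 < m

namespace IsDriftWalk

variable {Ω : Type*} [MeasurableSpace Ω] {P : Measure Ω}
  {Z : ℕ → Ω → ℝ} {m v : ℝ}

lemma variance_nonneg' (hZ : IsDriftWalk P Z m v) : 0 ≤ v :=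
  hZ.variance ▸ variance_nonneg _ _

lemma measurable_cusum_comp (hZ : IsDriftWalk P Z m v) (t : ℕ) :
    Measurable fun ω => cusum (fun n => Z n ω) t :=
  (measurable_cusum t).comp (measurable_pi_lambda _ hZ.measurable)

lemma measurable_partialSups_cusum_comp (hZ : IsDriftWalk P Z m v) (t : ℕ) :
    Measurable fun ω => partialSups (cusum fun n => Z n ω) t :=
  (measurable_partialSups_cusum t).comp (measurable_pi_lambda _ hZ.measurable)

variable [IsProbabilityMeasure P]

/-- Reindexing by an injection keeps the increments i.i.d., so one inequality serves initial
segments, later blocks and the time-reversed walk. -/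
lemma maximal_ineq (hZ : IsDriftWalk P Z m v) {g : ℕ → ℕ} (hg : g.Injective) (n : ℕ) {a : ℝ}
    (ha : 0 < a) :
    P.real {ω | ∃ k ≤ n, a ≤ |∑ i ∈ Finset.range k, (Z (g i) ω - m)|} ≤ n * v / a ^ 2 := by
  have hL (i : ℕ) : MemLp (Z i) 2 P := (hZ.ident i).memLp_iff.2 hZ.memLp
  refine kolmogorov_maximal (Y := fun i ω => Z (g i) ω - m) ?_
    (fun i => (hZ.measurable _).sub_const m) (fun i => (hL _).sub (memLp_const m)) (fun i => ?_) (fun i => ?_) n ha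
  · exact (hZ.indep.precomp hg).comp (fun _ x => x - m) fun _ => by fun_prop
  · rw [integral_sub ((hL _).integrable one_le_two) (integrable_const _),
      (hZ.ident (g i)).integral_eq, hZ.mean]
    simp
  · rw [variance_sub_const (hL _).1, (hZ.ident (g i)).variance_eq, hZ.variance]

/-- Chebyshev's inequality for the sum over a block of `n` consecutive increments. -/
lemma prob_block_sum_le (hZ : IsDriftWalk P Z m v) (k n : ℕ) {h : ℝ} (hn : h < n) :
    P.real {ω | ∑ i ∈ Finset.range (k + n), Z i ω - ∑ i ∈ Finset.range k, Z i ω ≤ m * h} ≤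
      n * v / (m * (n - h)) ^ 2 := by
  have hm := hZ.drift_pos
  have ha : 0 < m * (n - h) := mul_pos hm (sub_pos.2 hn)
  refine le_trans (measureReal_mono ?_) (hZ.maximal_ineq (add_right_injective k) n ha)
  intro ω hω
  refine ⟨n, le_rfl, ?_⟩
  simp only [Set.mem_ofPred_eq, Finset.sum_range_add, add_sub_cancel_left] at hω
  rw [Finset.sum_sub_distrib, Finset.sum_const, Finset.card_range, nsmul_eq_mul, abs_sub_comm]
  exact le_trans (by nlinarith) (le_abs_self _)

/-- The running maximum is at most some `S_u - S_j` with `j ≤ u ≤ n`, whose drift is at most `m n`.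
One of the two centred sums must therefore deviate by half of `m (h - n)`, whence the factor 4. -/
lemma prob_lt_partialSups_cusum (hZ : IsDriftWalk P Z m v) (n : ℕ) {h : ℝ} (hn : n < h) :
    P.real {ω | m * h < partialSups (cusum fun n => Z n ω) n} ≤
      4 * (n * v / (m * (h - n)) ^ 2) := by
  have hm := hZ.drift_pos
  have ha : 0 < m * (h - n) / 2 := by have := mul_pos hm (sub_pos.2 hn); positivity
  refine le_trans (measureReal_mono fun ω hω => ?_)
    ((hZ.maximal_ineq Function.injective_id n ha).trans_eq (by field_simp; ring))
  by_contra hcon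
  simp only [Set.mem_ofPred_eq, not_exists, not_and, not_le, id] at hcon hω
  obtain ⟨u, hu, j, hj, hle⟩ := exists_partialSups_cusum_le (fun n => Z n ω) n
  have h1 := abs_lt.1 (hcon u hu)
  have h2 := abs_lt.1 (hcon j (hj.trans hu))
  simp only [Finset.sum_sub_distrib, Finset.sum_const, Finset.card_range, nsmul_eq_mul] at h1 h2
  have h3 : (u : ℝ) * m ≤ n * m := by gcongr
  have h4 : 0 ≤ (j : ℝ) * m := by positivity
  linarith [h1.2, h2.1]

/-- The walk is unlikely to fall far below its starting point. -/
lemma prob_exists_sum_lt (hZ : IsDriftWalk P Z m v) {g : ℕ → ℕ} (hg : g.Injective) (n : ℕ)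
    {r d : ℝ} (hr : 0 < r) (hd : 0 < d) :
    P.real {ω | ∃ k ≤ n, r ≤ -∑ i ∈ Finset.range k, Z (g i) ω} ≤
      d * v / r ^ 2 + n * v / (m * d) ^ 2 := by
  have hm := hZ.drift_pos
  have hv := hZ.variance_nonneg'
  -- Split at time `d`: up to `d` the centred walk itself has to fall by `r`; after `d` it has to
  -- cancel an accumulated drift of at least `m d`.
  have h1 := hZ.maximal_ineq hg ⌊d⌋₊ hr
  have h2 := hZ.maximal_ineq hg n (mul_pos hm hd)
  have h3 : ⌊d⌋₊ * v / r ^ 2 ≤ d * v / r ^ 2 := by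
    gcongr; exact Nat.floor_le hd.le
  refine le_trans (measureReal_mono ?_) ((measureReal_union_le _ _).trans
    (add_le_add (h1.trans h3) h2))
  rintro ω ⟨k, hk, hω⟩
  have e : ∑ i ∈ Finset.range k, (Z (g i) ω - m) = ∑ i ∈ Finset.range k, Z (g i) ω - k * m := by
    simp
  rcases le_or_gt k ⌊d⌋₊ with hkd | hkd
  · refine Or.inl ⟨k, hkd, ?_⟩
    rw [e, abs_sub_comm]
    refine le_trans ?_ (le_abs_self _)
    have : 0 ≤ (k : ℝ) * m := by positivity
    linarith
  · refine Or.inr ⟨k, hk, ?_⟩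
    rw [e, abs_sub_comm]
    refine le_trans ?_ (le_abs_self _)
    have : d * m ≤ (k : ℝ) * m := by gcongr; exact (Nat.lt_of_floor_lt hkd).le
    linarith

/-- If the maximum is at most `S_u - S_j`, the gap is at most `-S_j - (S_n - S_u)`. A gap of `2 r`
makes either the walk or the walk read backwards from time `n` drop by `r`. -/
lemma prob_partialSups_cusum_sub_sum (hZ : IsDriftWalk P Z m v) (n : ℕ) {r d : ℝ} (hr : 0 < r)
    (hd : 0 < d) :
    P.real {ω | 2 * r ≤ partialSups (cusum fun n => Z n ω) n - ∑ i ∈ Finset.range n, Z i ω} ≤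
      2 * (d * v / r ^ 2 + n * v / (m * d) ^ 2) := by
  -- Time reversal of the first `n` indices, extended by the identity to be injective on `ℕ`.
  let g : ℕ → ℕ := fun i => if i < n then n - 1 - i else i
  have hg : g.Injective := by
    intro i j hij
    simp only [g] at hij
    split_ifs at hij <;> omega
  have h1 := hZ.prob_exists_sum_lt Function.injective_id n hr hd
  have h2 := hZ.prob_exists_sum_lt hg n hr hd
  rw [two_mul (d * v / _ + _)]
  refine le_trans (measureReal_mono ?_) ((measureReal_union_le _ _).trans (add_le_add h1 h2))
  intro ω hω
  simp only [Set.mem_ofPred_eq] at hω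
  obtain ⟨u, hu, j, hj, hle⟩ := exists_partialSups_cusum_le (fun n => Z n ω) n
  by_contra hcon
  simp only [Set.mem_union, Set.mem_ofPred_eq, not_or, not_exists, not_and, not_le, id] at hcon
  have h3 := hcon.1 j (hj.trans hu)
  have h4 := hcon.2 (n - u) (by omega)
  have e : ∑ i ∈ Finset.range (n - u), Z (g i) ω =
      ∑ i ∈ Finset.range n, Z i ω - ∑ i ∈ Finset.range u, Z i ω := by
    rw [← Finset.sum_Ico_eq_sub _ hu]
    refine Finset.sum_bij' (fun i _ => n - 1 - i) (fun i _ => n - 1 - i) ?_ ?_ ?_ ?_ ?_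
    · intro i hi; simp at hi ⊢; omega
    · intro i hi; simp at hi ⊢; omega
    · intro i hi; simp at hi ⊢; omega
    · intro i hi; simp at hi ⊢; omega
    · intro i hi
      simp only [Finset.mem_range] at hi
      simp only [g, if_pos (show i < n by omega)]
  rw [e] at h4
  linarith

end IsDriftWalk

/-! ### The time `⌊h + x √h⌋` for large `h` -/

section FloorTime

variable (x : ℝ)

lemma tendsto_mul_sqrt_div_self : Tendsto (fun h : ℝ => (h + x * √h) / h) atTop (𝓝 1) := by
  have h1 : Tendsto (fun h : ℝ => 1 + x * (√h)⁻¹) atTop (𝓝 (1 + x * 0)) :=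
    tendsto_const_nhds.add ((tendsto_inv_atTop_zero.comp Real.tendsto_sqrt_atTop).const_mul x)
  rw [mul_zero, add_zero] at h1
  refine h1.congr' ?_
  filter_upwards [eventually_gt_atTop 0] with h hh
  have := Real.sq_sqrt hh.le
  have h0 : 0 < √h := Real.sqrt_pos.2 hh
  rw [eq_div_iff hh.ne']
  field_simp
  linear_combination -x * this

lemma tendsto_add_mul_sqrt : Tendsto (fun h : ℝ => h + x * √h) atTop atTop := by
  refine (tendsto_id.atTop_mul_pos one_pos (tendsto_mul_sqrt_div_self x)).congr' ?_
  filter_upwards [eventually_gt_atTop 0] with h hh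
  rw [id, mul_div_cancel₀ _ hh.ne']

lemma tendsto_floor_add_mul_sqrt : Tendsto (fun h : ℝ => ⌊h + x * √h⌋₊) atTop atTop :=
  tendsto_nat_floor_atTop.comp (tendsto_add_mul_sqrt x)

lemma tendsto_floor_div_self :
    Tendsto (fun h : ℝ => (⌊h + x * √h⌋₊ : ℝ) / h) atTop (𝓝 1) := by
  have h1 := (tendsto_nat_floor_div_atTop (R := ℝ)).comp (tendsto_add_mul_sqrt x)
  have h2 := h1.mul (tendsto_mul_sqrt_div_self x)
  rw [mul_one] at h2
  refine h2.congr' ?_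
  filter_upwards [(tendsto_add_mul_sqrt x).eventually_gt_atTop 0] with h hh
  simp only [Function.comp]
  field_simp

/-- The central limit theorem normalises by the square root of the time, not of `h`; the ratio of
the two tends to 1 and rounding costs at most 1. -/
lemma tendsto_floor_sub_div_sqrt :
    Tendsto (fun h : ℝ => (√⌊h + x * √h⌋₊)⁻¹ * (⌊h + x * √h⌋₊ - h)) atTop (𝓝 x) := by
  have h1 : Tendsto (fun h : ℝ => (⌊h + x * √h⌋₊ - h) / √h) atTop (𝓝 x) := by
    have hinv : Tendsto (fun h : ℝ => x - (√h)⁻¹) atTop (𝓝 (x - 0)) :=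
      tendsto_const_nhds.sub (tendsto_inv_atTop_zero.comp Real.tendsto_sqrt_atTop)
    rw [sub_zero] at hinv
    refine tendsto_of_tendsto_of_tendsto_of_le_of_le' hinv tendsto_const_nhds ?_ ?_
    · filter_upwards [eventually_gt_atTop 0] with h hh
      have h0 : 0 < √h := Real.sqrt_pos.2 hh
      have := Nat.lt_floor_add_one (h + x * √h)
      rw [le_div_iff₀ h0, sub_mul, inv_mul_cancel₀ h0.ne']
      linarith
    · filter_upwards [eventually_gt_atTop 0,
        (tendsto_add_mul_sqrt x).eventually_gt_atTop 0] with h hh hp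
      have h0 : 0 < √h := Real.sqrt_pos.2 hh
      have := Nat.floor_le hp.le
      rw [div_le_iff₀ h0]
      linarith
  have h2 : Tendsto (fun h : ℝ => √((⌊h + x * √h⌋₊ : ℝ) / h)) atTop (𝓝 1) := by
    simpa using (tendsto_floor_div_self x).sqrt
  have h3 := h1.div h2 one_ne_zero
  rw [div_one] at h3
  refine h3.congr' ?_
  filter_upwards [eventually_gt_atTop 0] with h hh
  have h0 : 0 < √h := Real.sqrt_pos.2 hh
  simp only [Pi.div_apply]
  rw [Real.sqrt_div' _ hh.le]
  field_simp

end FloorTime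

/-! ### Central limit theorem for level crossings -/

namespace IsDriftWalk

variable {Ω : Type*} [MeasurableSpace Ω] {P : Measure Ω} [IsProbabilityMeasure P]
  {Z : ℕ → Ω → ℝ} {m v : ℝ}

/-- This makes the CUSUM maximum and the walk interchangeable at the scale of the central limit
theorem. -/
lemma tendsto_prob_overshoot (hZ : IsDriftWalk P Z m v) {ε : ℝ} (hε : 0 < ε) :
    Tendsto (fun n : ℕ => P.real {ω | ε * √n ≤
      partialSups (cusum fun n => Z n ω) n - ∑ i ∈ Finset.range n, Z i ω}) atTop (𝓝 0) := by
  have hm := hZ.drift_pos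
  have l1 : Tendsto (fun n : ℕ => (n : ℝ) ^ (-(1 / 4) : ℝ)) atTop (𝓝 0) :=
    (tendsto_rpow_neg_atTop (by norm_num)).comp tendsto_natCast_atTop_atTop
  have l2 : Tendsto (fun n : ℕ => (n : ℝ) ^ (-(1 / 2) : ℝ)) atTop (𝓝 0) :=
    (tendsto_rpow_neg_atTop (by norm_num)).comp tendsto_natCast_atTop_atTop
  have l3 := ((l1.const_mul (4 * v / ε ^ 2)).add (l2.const_mul (v / m ^ 2))).const_mul 2
  simp only [mul_zero, add_zero] at l3
  refine tendsto_of_tendsto_of_tendsto_of_le_of_le' tendsto_const_nhds l3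
    (Eventually.of_forall fun n => measureReal_nonneg) ?_
  filter_upwards [eventually_gt_atTop 0] with n hn
  have hn' : (0 : ℝ) < n := by exact_mod_cast hn
  have hr : 0 < ε * √n / 2 := by positivity
  -- The split time `d = n^(3/4)` lies strictly between the orders `√n` and `n`, so that `d / n` and
  -- `n / d²` both vanish.
  have hd : 0 < (n : ℝ) ^ (3 / 4 : ℝ) := by positivity
  have := hZ.prob_partialSups_cusum_sub_sum n hr hd
  rw [mul_div_cancel₀ _ (two_ne_zero' ℝ)] at this
  refine this.trans_eq ?_
  have e1 : (n : ℝ) ^ (3 / 4 : ℝ) = n * (n : ℝ) ^ (-(1 / 4) : ℝ) := by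
    nth_rw 2 [← Real.rpow_one (n : ℝ)]
    rw [← Real.rpow_add hn']; norm_num
  have e2 : (n : ℝ) / ((n : ℝ) ^ (3 / 4 : ℝ)) ^ 2 = (n : ℝ) ^ (-(1 / 2) : ℝ) := by
    rw [← Real.rpow_natCast, ← Real.rpow_mul hn'.le]
    nth_rw 1 [← Real.rpow_one (n : ℝ)]
    rw [← Real.rpow_sub hn']; norm_num
  congr 2
  · rw [e1, div_pow, mul_pow, Real.sq_sqrt hn'.le]
    field_simp
    ring
  · rw [← e2, mul_pow]
    field_simp

/-- Any statistic squeezed between the walk and the running maximum of its CUSUM statistic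
satisfies the central limit theorem for level crossings. -/
theorem tendsto_prob_lt (hZ : IsDriftWalk P Z m v) {U : ℕ → Ω → ℝ} (hU : ∀ n, Measurable (U n))
    (hlow : ∀ n ω, ∑ i ∈ Finset.range n, Z i ω ≤ U n ω)
    (hup : ∀ n ω, U n ω ≤ partialSups (cusum fun n => Z n ω) n) {x : ℝ} (hx : x ≠ 0) :
    Tendsto (fun h : ℝ => P.real {ω | m * h < U ⌊h + x * √h⌋₊ ω}) atTop
      (𝓝 ((gaussianReal 0 (v.toNNReal / m.toNNReal ^ 2)).real (Set.Iic x))) := by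
  have hm := hZ.drift_pos
  have hv := hZ.variance_nonneg'
  set w : ℝ≥0 := v.toNNReal / m.toNNReal ^ 2 with hw
  set t : ℝ → ℕ := fun h => ⌊h + x * √h⌋₊ with ht
  have htop : Tendsto t atTop atTop := tendsto_floor_add_mul_sqrt x
  -- The Gaussian limit is written as `-m y`, by symmetry, so that the crossing event `-m y + m x >
  -- 0` reads `y < x`.
  have hlaw : HasLaw (fun y : ℝ => -m * y) (gaussianReal 0 Var[Z 0; P].toNNReal)
      (gaussianReal 0 w) := by
    refine ⟨by fun_prop, ?_⟩
    rw [gaussianReal_map_const_mul, hZ.variance]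
    congr 1
    · simp
    · ext
      simp only [NNReal.coe_mul, NNReal.coe_mk, hw, NNReal.coe_div, NNReal.coe_pow,
        Real.coe_toNNReal _ hv, Real.coe_toNNReal _ hm.le]
      field_simp
  have clt := tendstoInDistribution_inv_sqrt_mul_sum_sub hlaw hZ.memLp hZ.indep hZ.ident
  have clt' : TendstoInDistribution
      (fun (h : ℝ) ω => (√(t h))⁻¹ * (∑ k ∈ Finset.range (t h), Z k ω - t h * P[Z 0])) atTop
      (fun y : ℝ => -m * y) (fun _ => P) (gaussianReal 0 w) :=
    ⟨fun h => clt.forall_aemeasurable (t h), clt.aemeasurable_limit, clt.tendsto.comp htop⟩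
  have hsumm (n : ℕ) : Measurable fun ω => ∑ i ∈ Finset.range n, Z i ω :=
    Finset.measurable_sum _ fun i _ => hZ.measurable i
  -- `R` is what must be added to the normalised centred sum to get the normalised `U - m h`. It
  -- tends to the constant `m x` in probability, so Slutsky's theorem applies.
  let R : ℝ → Ω → ℝ := fun h ω =>
    (√(t h))⁻¹ * (U (t h) ω - ∑ i ∈ Finset.range (t h), Z i ω) + m * ((√(t h))⁻¹ * (t h - h))
  have hRm (h : ℝ) : Measurable (R h) :=
    (((hU _).sub (hsumm _)).const_mul _).add_const _
  have hR : TendstoInMeasure P R atTop (fun _ => m * x) := by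
    rw [tendstoInMeasure_iff_measureReal_norm]
    intro ε hε
    have hdet : Tendsto (fun h : ℝ => m * ((√(t h))⁻¹ * (t h - h))) atTop (𝓝 (m * x)) :=
      (tendsto_floor_sub_div_sqrt x).const_mul m
    have hz := (hZ.tendsto_prob_overshoot (half_pos hε)).comp htop
    refine tendsto_of_tendsto_of_tendsto_of_le_of_le' tendsto_const_nhds hz
      (Eventually.of_forall fun n => measureReal_nonneg) ?_
    filter_upwards [(Metric.tendsto_nhds.1 hdet) (ε / 2) (half_pos hε),
      htop.eventually_gt_atTop 0] with h h1 h2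
    have h2' : (0 : ℝ) < √(t h) := Real.sqrt_pos.2 (by exact_mod_cast h2)
    refine measureReal_mono fun ω hω => ?_
    simp only [Set.mem_ofPred_eq, Real.norm_eq_abs, R] at hω ⊢
    rw [Real.dist_eq] at h1
    have h3 : 0 ≤ (√(t h))⁻¹ * (U (t h) ω - ∑ i ∈ Finset.range (t h), Z i ω) :=
      mul_nonneg (by positivity) (sub_nonneg.2 (hlow _ _))
    have h4 : ε / 2 ≤ (√(t h))⁻¹ * (U (t h) ω - ∑ i ∈ Finset.range (t h), Z i ω) := by
      have := abs_add_le ((√(t h))⁻¹ * (U (t h) ω - ∑ i ∈ Finset.range (t h), Z i ω))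
        (m * ((√(t h))⁻¹ * (t h - h)) - m * x)
      rw [← add_sub_assoc, abs_of_nonneg h3] at this
      linarith
    rw [inv_mul_eq_div, le_div_iff₀ h2'] at h4
    exact h4.trans (sub_le_sub_right (hup _ _) _)
  have hsum := clt'.add_of_tendstoInMeasure_const hR fun h => (hRm h).aemeasurable
  -- For variance zero the limit is the point mass at `0`; here `x ≠ 0` is essential.
  have hatom : gaussianReal 0 w {x} = 0 := by
    by_cases h : w = 0
    · simp [h, hx.symm]
    · have := nullSingletonClass_gaussianReal (μ := 0) h
      exact measure_singleton x
  have hmapm : Measurable fun y : ℝ => -m * y + m * x := by fun_prop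
  have hnull : (gaussianReal 0 w).map (fun y : ℝ => -m * y + m * x) (frontier (Set.Ioi 0)) = 0 := by
    rw [frontier_Ioi, Measure.map_apply hmapm (measurableSet_singleton _)]
    convert hatom using 2
    ext y
    simp only [Set.mem_preimage, Set.mem_singleton_iff]
    constructor
    · intro h
      have : m * (x - y) = 0 := by linarith
      rcases mul_eq_zero.1 this with h | h <;> linarith
    · rintro rfl; ring
  have hpm := ProbabilityMeasure.tendsto_measure_of_null_frontier_of_tendsto' hsum.tendsto hnull
  have hpm' := (ENNReal.tendsto_toReal
    (measure_ne_top ((gaussianReal 0 w).map fun y : ℝ => -m * y + m * x) _)).comp hpm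
  have elim : (gaussianReal 0 w).real (Set.Iic x) = ((gaussianReal 0 w).map
      (fun y : ℝ => -m * y + m * x)).real (Set.Ioi 0) := by
    rw [map_measureReal_apply hmapm measurableSet_Ioi]
    have e : (fun y : ℝ => -m * y + m * x) ⁻¹' Set.Ioi 0 = Set.Iio x := by
      ext y
      simp only [Set.mem_preimage, Set.mem_Ioi, Set.mem_Iio]
      constructor
      · intro h; nlinarith
      · intro h; nlinarith
    rw [e]
    refine measureReal_congr ?_
    refine (ae_eq_set.2 ⟨?_, ?_⟩)
    · exact measure_mono_null (fun y hy => le_antisymm hy.1 (not_lt.1 hy.2)) hatom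
    · simp [Set.sdiff_eq_empty.2 Set.Iio_subset_Iic_self]
  rw [elim]
  refine Tendsto.congr' ?_ hpm'
  filter_upwards [htop.eventually_gt_atTop 0] with h h2
  have h2' : (0 : ℝ) < √(t h) := Real.sqrt_pos.2 (by exact_mod_cast h2)
  simp only [Function.comp, ProbabilityMeasure.coe_mk]
  rw [Measure.map_apply_of_aemeasurable (hsum.forall_aemeasurable h) measurableSet_Ioi,
    measureReal_def]
  congr 2
  ext ω
  have e : (√(t h))⁻¹ * (∑ k ∈ Finset.range (t h), Z k ω - t h * P[Z 0]) + R h ω =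
      (√(t h))⁻¹ * (U (t h) ω - m * h) := by
    simp only [R, hZ.mean]; ring
  simp only [Set.mem_preimage, Set.mem_Ioi, Set.mem_ofPred_eq, Pi.add_apply, e]
  rw [mul_pos_iff_of_pos_left (inv_pos.2 h2'), sub_pos]

end IsDriftWalk

/-! ### Counting independent events -/

section Count

variable {ι : Type*} [Fintype ι]

/-- The probability that at least `M` of the independent events with probabilities `p i` occur. -/
def countProb [DecidableEq ι] (M : ℕ) (p : ι → ℝ) : ℝ :=
  ∑ T ∈ (Finset.univ : Finset (Finset ι)).filter (M ≤ ·.card),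
    ∏ i, if i ∈ T then p i else 1 - p i

lemma continuous_countProb [DecidableEq ι] (M : ℕ) :
    Continuous (countProb M : (ι → ℝ) → ℝ) := by
  refine continuous_finsetSum _ fun T _ => continuous_finsetProd _ fun i _ => ?_
  by_cases h : i ∈ T
  · simpa [h] using continuous_apply i
  · simp only [h, if_false]; fun_prop

/-- A counting condition becomes a finite union of finite intersections, from which measurability
and closedness can be read off. -/
lemma le_ncard_setOf_iff (M : ℕ) (p : ι → Prop) :
    M ≤ {i | p i}.ncard ↔ ∃ T : Finset ι, M ≤ T.card ∧ ∀ i ∈ T, p i := by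
  classical
  have e : {i | p i}.ncard = (Finset.univ.filter p).card := by
    rw [← Set.ncard_coe_finset]; simp
  rw [e]
  constructor
  · exact fun h => ⟨_, h, fun i hi => (Finset.mem_filter.1 hi).2⟩
  · rintro ⟨T, hT, h⟩
    exact hT.trans (Finset.card_le_card fun i hi => by simp [h i hi])

lemma measurableSet_le_ncard {Ω : Type*} [MeasurableSpace Ω] (M : ℕ) {A : ι → Set Ω}
    (hA : ∀ i, MeasurableSet (A i)) : MeasurableSet {ω | M ≤ {i | ω ∈ A i}.ncard} := by
  simp_rw [le_ncard_setOf_iff]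
  have e : {ω | ∃ T : Finset ι, M ≤ T.card ∧ ∀ i ∈ T, ω ∈ A i} =
      ⋃ T : Finset ι, ⋃ (_ : M ≤ T.card), ⋂ i ∈ T, A i := by
    ext; simp
  rw [e]
  exact MeasurableSet.iUnion fun T => MeasurableSet.iUnion fun _ =>
    T.measurableSet_biInter fun i _ => hA i

lemma prob_le_ncard [DecidableEq ι] {Ω : Type*} [MeasurableSpace Ω] {P : Measure Ω}
    {β : ι → Type*} [∀ i, MeasurableSpace (β i)] {Y : (i : ι) → Ω → β i} (hY : iIndepFun Y P)
    (hm : ∀ i, Measurable (Y i)) {B : (i : ι) → Set (β i)} (hB : ∀ i, MeasurableSet (B i))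
    (M : ℕ) :
    P.real {ω | M ≤ {i | Y i ω ∈ B i}.ncard} = countProb M fun i => P.real {ω | Y i ω ∈ B i} := by
  classical
  have := hY.isProbabilityMeasure
  -- `A T` says that exactly the events indexed by `T` occur; these sets partition the space.
  let A : Finset ι → Set Ω := fun T => ⋂ i, Y i ⁻¹' (if i ∈ T then B i else (B i)ᶜ)
  have hA' (T : Finset ι) (i : ι) : MeasurableSet (if i ∈ T then B i else (B i)ᶜ) := by
    split_ifs
    exacts [hB i, (hB i).compl]
  have hA (T : Finset ι) : MeasurableSet (A T) := MeasurableSet.iInter fun i => hm i (hA' T i)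
  have hmem (T : Finset ι) (ω : Ω) : ω ∈ A T ↔ Finset.univ.filter (fun i => Y i ω ∈ B i) = T := by
    simp only [A, Set.mem_iInter, Set.mem_preimage, Finset.ext_iff, Finset.mem_filter,
      Finset.mem_univ, true_and]
    refine forall_congr' fun i => ?_
    by_cases h : i ∈ T <;> simp [h]
  have e : {ω | M ≤ {i | Y i ω ∈ B i}.ncard} =
      ⋃ T ∈ (Finset.univ : Finset (Finset ι)).filter (M ≤ ·.card), A T := by
    ext ω
    have e1 : {i | Y i ω ∈ B i}.ncard = (Finset.univ.filter fun i => Y i ω ∈ B i).card := by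
      rw [← Set.ncard_coe_finset]; simp
    simp only [Set.mem_ofPred_eq, e1, Set.mem_iUnion, hmem, exists_prop, Finset.mem_filter,
      Finset.mem_univ, true_and]
    simp
  rw [e, measureReal_biUnion_finset _ fun T _ => hA T]
  · refine Finset.sum_congr rfl fun T _ => ?_
    have h := hY.measure_inter_preimage_eq_mul Finset.univ
      (sets := fun i => if i ∈ T then B i else (B i)ᶜ) fun i _ => hA' T i
    have h' : A T = ⋂ i ∈ Finset.univ, Y i ⁻¹' (if i ∈ T then B i else (B i)ᶜ) := by simp [A]
    rw [h', measureReal_def, h, ENNReal.toReal_prod]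
    refine Finset.prod_congr rfl fun i _ => ?_
    by_cases hi : i ∈ T
    · simp only [hi, if_true]; rfl
    · simp only [hi, if_false, Set.preimage_compl]
      exact probReal_compl_eq_one_sub (hm i (hB i))
  · intro T _ T' _ hne
    refine Set.disjoint_left.2 fun ω h1 h2 => hne ?_
    rw [← (hmem T ω).1 h1, (hmem T' ω).1 h2]

end Count

/-! ### Order statistics -/

section OrderStat

variable {ι : Type*} [Fintype ι] {M : ℕ}

/-- The set under the infimum is upward closed and closed, nonempty because `M ≤ card ι` and bounded
below because `1 ≤ M`. The infimum is therefore attained. -/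
lemma orderStat_le_iff (h1 : 1 ≤ M) (h2 : M ≤ Fintype.card ι) (x : ι → ℝ) (y : ℝ) :
    orderStat M x ≤ y ↔ M ≤ {i | x i ≤ y}.ncard := by
  set S : Set ℝ := {y : ℝ | M ≤ {i : ι | x i ≤ y}.ncard} with hS
  have hS' : S = ⋃ T : Finset ι, ⋃ (_ : M ≤ T.card), ⋂ i ∈ T, Set.Ici (x i) := by
    ext y; simp [hS, le_ncard_setOf_iff]
  have hup : ∀ y ∈ S, ∀ y', y ≤ y' → y' ∈ S := fun y hy y' hle =>
    le_trans hy (Set.ncard_le_ncard fun i (hi : x i ≤ y) => hi.trans hle)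
  have hne : S.Nonempty := by
    refine ⟨∑ i, |x i|, (le_ncard_setOf_iff _ _).2 ⟨Finset.univ, by simpa using h2, fun i _ => ?_⟩⟩
    exact (le_abs_self _).trans
      (Finset.single_le_sum (f := fun i => |x i|) (fun j _ => abs_nonneg _) (Finset.mem_univ i))
  have hbdd : BddBelow S := by
    refine ⟨-∑ i, |x i|, fun y hy => ?_⟩
    obtain ⟨T, hT, h⟩ := (le_ncard_setOf_iff _ _).1 hy
    obtain ⟨i, hi⟩ := Finset.card_pos.1 (h1.trans hT)
    have := Finset.single_le_sum (f := fun i => |x i|) (fun j _ => abs_nonneg _)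
      (Finset.mem_univ i)
    linarith [h i hi, neg_abs_le (x i)]
  have hcl : IsClosed S := by
    rw [hS']
    refine isClosed_iUnion_of_finite fun T => isClosed_iUnion_of_finite fun _ => ?_
    exact isClosed_biInter fun i _ => isClosed_Ici
  have hmem : sInf S ∈ S := hcl.csInf_mem hne hbdd
  exact ⟨fun h => hup _ hmem _ h, fun h => csInf_le hbdd h⟩

lemma abs_orderStat_le (h1 : 1 ≤ M) (h2 : M ≤ Fintype.card ι) (x : ι → ℝ) :
    |orderStat M x| ≤ ∑ i, |x i| := by
  rw [abs_le]
  constructor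
  · obtain ⟨T, hT, h⟩ := (le_ncard_setOf_iff _ _).1 ((orderStat_le_iff h1 h2 x _).1 le_rfl)
    obtain ⟨i, hi⟩ := Finset.card_pos.1 (h1.trans hT)
    have := Finset.single_le_sum (f := fun i => |x i|) (fun j _ => abs_nonneg _)
      (Finset.mem_univ i)
    linarith [h i hi, neg_abs_le (x i)]
  · refine (orderStat_le_iff h1 h2 x _).2 ((le_ncard_setOf_iff _ _).2
      ⟨Finset.univ, by simpa using h2, fun i _ => ?_⟩)
    exact (le_abs_self _).trans
      (Finset.single_le_sum (f := fun i => |x i|) (fun j _ => abs_nonneg _) (Finset.mem_univ i))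

lemma measurable_orderStat (h1 : 1 ≤ M) (h2 : M ≤ Fintype.card ι) :
    Measurable fun x : ι → ℝ => orderStat M x := by
  refine measurable_of_Iic fun y => ?_
  have e : (fun x : ι → ℝ => orderStat M x) ⁻¹' Set.Iic y =
      {x | M ≤ {i | x ∈ {x : ι → ℝ | x i ≤ y}}.ncard} := by
    ext x; simp [orderStat_le_iff h1 h2]
  rw [e]
  exact measurableSet_le_ncard M fun i => measurableSet_le (measurable_pi_apply i) measurable_const

lemma integrable_orderStat (h1 : 1 ≤ M) (h2 : M ≤ Fintype.card ι) (μ : ι → Measure ℝ)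
    [∀ i, IsProbabilityMeasure (μ i)] (hμ : ∀ i, Integrable id (μ i)) :
    Integrable (fun x => orderStat M x) (Measure.pi μ) := by
  have : Integrable (fun x : ι → ℝ => ∑ i, |x i|) (Measure.pi μ) :=
    integrable_finsetSum _ fun i _ => ((measurePreserving_eval μ i).integrable_comp_of_integrable
      (hμ i)).abs
  exact this.mono' (measurable_orderStat h1 h2).aestronglyMeasurable
    (Eventually.of_forall fun x => abs_orderStat_le h1 h2 x)

/-- The order statistic is at most `y` exactly when at least `M` of the independent coordinates are,
which brings in the same polynomial as for the sensors. -/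
lemma prob_lt_orderStat [DecidableEq ι] (h1 : 1 ≤ M) (h2 : M ≤ Fintype.card ι)
    (μ : ι → Measure ℝ) [∀ i, IsProbabilityMeasure (μ i)] (y : ℝ) :
    (Measure.pi μ).real {x | y < orderStat M x} =
      1 - countProb M fun i => (μ i).real (Set.Iic y) := by
  have hind : iIndepFun (fun (i : ι) (x : ι → ℝ) => x i) (Measure.pi μ) :=
    iIndepFun_pi (X := fun _ x => x) fun i => aemeasurable_id
  have h := prob_le_ncard hind measurable_pi_apply (B := fun _ => Set.Iic y)
    (fun _ => measurableSet_Iic) M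
  have e (i : ι) : (Measure.pi μ).real {x : ι → ℝ | x i ∈ Set.Iic y} = (μ i).real (Set.Iic y) :=
    (measurePreserving_eval μ i).measureReal_preimage measurableSet_Iic.nullMeasurableSet
  simp only [e] at h
  rw [← h, ← probReal_compl_eq_one_sub]
  · congr 1
    ext x
    simp [← orderStat_le_iff h1 h2]
  · exact measurableSet_le_ncard M (A := fun i => {x : ι → ℝ | x i ∈ Set.Iic y})
      fun i => measurable_pi_apply i measurableSet_Iic

end OrderStat

/-! ### Tail integrals and the second-order expansion of a sum -/

section Tail

variable {Ω : Type*} [MeasurableSpace Ω] {μ : Measure Ω} [IsProbabilityMeasure μ]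

/-- The mean as the integral of the tail function minus that of the point mass at `0`. -/
lemma integral_eq_integral_tail {O : Ω → ℝ} (hOm : Measurable O) (hO : Integrable O μ)
    (hint : Integrable fun x : ℝ => μ.real {ω | x < O ω} - (Set.Iic 0).indicator 1 x) :
    ∫ ω, O ω ∂μ = ∫ x : ℝ, (μ.real {ω | x < O ω} - (Set.Iic 0).indicator 1 x) := by
  have hp : ∫ ω, max (O ω) 0 ∂μ = ∫ x in Set.Ioi 0, μ.real {ω | x < O ω} := by
    rw [hO.pos_part.integral_eq_integral_meas_lt (Eventually.of_forall fun ω => le_max_right _ _)]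
    refine setIntegral_congr_fun measurableSet_Ioi fun x hx => ?_
    congr 1
    ext ω
    simp [(not_lt.2 (le_of_lt (Set.mem_Ioi.1 hx)))]
  have hn : ∫ ω, max (-O ω) 0 ∂μ = ∫ x in Set.Iic 0, (1 - μ.real {ω | x < O ω}) := by
    rw [hO.neg_part.integral_eq_integral_meas_le (Eventually.of_forall fun ω => le_max_right _ _)]
    have := integral_comp_neg_Ioi (0 : ℝ) fun x => 1 - μ.real {ω | x < O ω}
    rw [neg_zero] at this
    rw [← this]
    refine setIntegral_congr_fun measurableSet_Ioi fun x hx => ?_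
    rw [← probReal_compl_eq_one_sub (measurableSet_lt measurable_const hOm)]
    congr 1
    ext ω
    simp only [Set.mem_ofPred_eq, le_max_iff, Set.mem_compl_iff, not_lt,
      not_le.2 (Set.mem_Ioi.1 hx), or_false]
    exact le_neg
  have hsplit : ∫ ω, O ω ∂μ = ∫ ω, max (O ω) 0 ∂μ - ∫ ω, max (-O ω) 0 ∂μ := by
    rw [← integral_sub hO.pos_part hO.neg_part]
    refine integral_congr_ae (Eventually.of_forall fun ω => ?_)
    rcases le_total (O ω) 0 with h | h
    · simp [h]
    · simp [h]
  rw [hsplit, hp, hn, ← intervalIntegral.integral_Iic_add_Ioi (b := 0) hint.integrableOn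
    hint.integrableOn, sub_eq_neg_add, ← integral_neg]
  congr 1
  · refine setIntegral_congr_fun measurableSet_Iic fun x hx => ?_
    simp [Set.indicator_of_mem hx]
  · refine setIntegral_congr_fun measurableSet_Ioi fun x hx => ?_
    simp [Set.indicator_of_notMem (Set.notMem_Iic.2 (Set.mem_Ioi.1 hx))]

end Tail

/-- As an integral, the series admits the change of variables `t = h + x √h`. -/
lemma tsum_eq_lintegral_floor (b : ℕ → ℝ≥0∞) :
    ∑' n, b n = ∫⁻ t in Set.Ioi (0 : ℝ), b ⌊t⌋₊ := by
  have hU : Set.Ici (0 : ℝ) = ⋃ n : ℕ, Set.Ico (n : ℝ) (n + 1) := by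
    ext t
    simp only [Set.mem_Ici, Set.mem_iUnion, Set.mem_Ico]
    constructor
    · exact fun ht => ⟨⌊t⌋₊, Nat.floor_le ht, Nat.lt_floor_add_one t⟩
    · rintro ⟨n, hn, -⟩; exact (Nat.cast_nonneg n).trans hn
  have hd : Pairwise (Function.onFun Disjoint fun n : ℕ => Set.Ico (n : ℝ) (n + 1)) := by
    intro i j hij
    refine Set.disjoint_left.2 fun t h1 h2 => hij ?_
    have e1 : ⌊t⌋₊ = i := Nat.floor_eq_on_Ico i t h1
    have e2 : ⌊t⌋₊ = j := Nat.floor_eq_on_Ico j t h2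
    omega
  rw [setLIntegral_congr (Ioi_ae_eq_Ici (a := (0 : ℝ))), hU,
    lintegral_iUnion (fun _ => measurableSet_Ico) hd]
  refine tsum_congr fun n => ?_
  rw [setLIntegral_congr_fun measurableSet_Ico
    (g := fun _ => b n) fun t ht => by simp only; rw [Nat.floor_eq_on_Ico n t ht]]
  simp

/-- Second-order expansion of `∑ B h n` around `h` when the profile `x ↦ B h ⌊h + x √h⌋` converges
to `V` with inverse-square domination away from its jump at `0`. -/
theorem tsum_expansion {B : ℝ → ℕ → ℝ} {V : ℝ → ℝ} (hVm : Measurable V)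
    (hB0 : ∀ h n, 0 ≤ B h n) (hB1 : ∀ h n, B h n ≤ 1) (C : ℝ)
    (hpos : ∀ᶠ h in atTop, ∀ x, 0 < x → B h ⌊h + x * √h⌋₊ ≤ C / x ^ 2)
    (hneg : ∀ᶠ h in atTop, ∀ x, x < 0 → -√h < x → 1 - B h ⌊h + x * √h⌋₊ ≤ C / x ^ 2)
    (hlim : ∀ x, x ≠ 0 → Tendsto (fun h => B h ⌊h + x * √h⌋₊) atTop (𝓝 (V x))) :
    Integrable (fun x => V x - (Set.Iic 0).indicator 1 x) ∧
    ∃ δ : ℝ → ℝ, Tendsto δ atTop (𝓝 0) ∧ ∀ᶠ h in atTop,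
      ∑' n, ENNReal.ofReal (B h n) = ENNReal.ofReal
        (h + ((∫ x, (V x - (Set.Iic 0).indicator 1 x)) + δ h) * √h) := by
  -- Subtracting the indicator of `(0, h]` removes the leading term `h`; `D` is the remainder in the
  -- variable `x`, with `dt = √h dx`.
  let f : ℝ → ℝ → ℝ := fun h t =>
    (Set.Ioi 0).indicator (fun t => B h ⌊t⌋₊) t - (Set.Ioc 0 h).indicator 1 t
  let D : ℝ → ℝ → ℝ := fun h x => f h (h + x * √h)
  have hfm (h : ℝ) : Measurable (f h) := by
    refine Measurable.sub (Measurable.indicator ?_ measurableSet_Ioi)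
      (measurable_one.indicator measurableSet_Ioc)
    exact (measurable_of_countable (B h)).comp Nat.measurable_floor
  have hDm (h : ℝ) : Measurable (D h) := (hfm h).comp (by fun_prop)
  have hD_pos (h : ℝ) (hh : 0 < h) (x : ℝ) (hx : 0 < x) : D h x = B h ⌊h + x * √h⌋₊ := by
    have hs : 0 < √h := Real.sqrt_pos.2 hh
    have : 0 < x * √h := by positivity
    simp only [D, f]
    rw [Set.indicator_of_mem (Set.mem_Ioi.2 (by linarith)),
      Set.indicator_of_notMem (by simp only [Set.mem_Ioc, not_and, not_le]; intro; linarith),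
      sub_zero]
  have hD_neg (h : ℝ) (hh : 0 < h) (x : ℝ) (hx : x ≤ 0) (hx' : -√h < x) :
      D h x = B h ⌊h + x * √h⌋₊ - 1 := by
    have hs : 0 < √h := Real.sqrt_pos.2 hh
    have h1 := Real.mul_self_sqrt hh.le
    have h2 : x * √h ≤ 0 := mul_nonpos_of_nonpos_of_nonneg hx hs.le
    have h3 : -√h * √h < x * √h := by gcongr
    simp only [D, f]
    rw [Set.indicator_of_mem (Set.mem_Ioi.2 (by linarith)),
      Set.indicator_of_mem (Set.mem_Ioc.2 ⟨by linarith, by linarith⟩), Pi.one_apply]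
  have hD_out (h : ℝ) (hh : 0 < h) (x : ℝ) (hx : x ≤ -√h) : D h x = 0 := by
    have hs : 0 < √h := Real.sqrt_pos.2 hh
    have h1 := Real.mul_self_sqrt hh.le
    have h3 : x * √h ≤ -√h * √h := by gcongr
    simp only [D, f]
    rw [Set.indicator_of_notMem (by simp only [Set.mem_Ioi, not_lt]; linarith),
      Set.indicator_of_notMem (by simp only [Set.mem_Ioc, not_and_or, not_lt]; left; linarith),
      sub_zero]
  -- From `|D| ≤ 1` and `x² |D| ≤ C` follows `(1 + x²) |D| ≤ 1 + C ≤ 2 max C 1`.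
  set K : ℝ := 2 * max C 1 with hK
  have hbound : ∀ᶠ h in atTop, ∀ x, x ≠ 0 → ‖D h x‖ ≤ K * (1 + x ^ 2)⁻¹ := by
    filter_upwards [hpos, hneg, eventually_gt_atTop 0] with h hp hn hh x hx
    have hC : C ≤ max C 1 := le_max_left _ _
    have h1C : 1 ≤ max C 1 := le_max_right _ _
    suffices hs : |D h x| ≤ 1 ∧ |D h x| ≤ C / x ^ 2 by
      have hx2 : 0 < x ^ 2 := by positivity
      have h2 := (le_div_iff₀ hx2).1 hs.2
      rw [Real.norm_eq_abs, ← div_eq_mul_inv, le_div_iff₀ (by positivity)]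
      linarith [hs.1]
    rcases lt_or_gt_of_ne hx with hx | hx
    · rcases lt_or_ge (-√h) x with hx' | hx'
      · rw [hD_neg h hh x hx.le hx', abs_sub_comm, abs_of_nonneg (by linarith [hB1 h ⌊h + x * √h⌋₊])]
        exact ⟨by linarith [hB0 h ⌊h + x * √h⌋₊], hn x hx hx'⟩
      · rw [hD_out h hh x hx', abs_zero]
        refine ⟨zero_le_one, ?_⟩
        -- The sign of `C` is not assumed; the bound at `-x > 0` shows `C / x² ≥ 0`.
        have hp' := hp (-x) (by linarith)
        rw [neg_sq] at hp'
        exact (hB0 _ _).trans hp'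
    · rw [hD_pos h hh x hx, abs_of_nonneg (hB0 _ _)]
      exact ⟨hB1 _ _, hp x hx⟩
  have hKint : Integrable fun x : ℝ => K * (1 + x ^ 2)⁻¹ := integrable_inv_one_add_sq.const_mul K
  have hne : ∀ᵐ x : ℝ, x ≠ 0 := by simp [ae_iff]
  have hptw (x : ℝ) (hx : x ≠ 0) :
      Tendsto (fun h => D h x) atTop (𝓝 (V x - (Set.Iic 0).indicator 1 x)) := by
    rcases lt_or_gt_of_ne hx with hx' | hx'
    · rw [Set.indicator_of_mem (Set.mem_Iic.2 hx'.le), Pi.one_apply]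
      refine ((hlim x hx).sub_const 1).congr' ?_
      filter_upwards [eventually_gt_atTop 0,
        Real.tendsto_sqrt_atTop.eventually_gt_atTop (-x)] with h hh hs
      exact (hD_neg h hh x hx'.le (by linarith)).symm
    · rw [Set.indicator_of_notMem (by simpa using hx'), sub_zero]
      refine (hlim x hx).congr' ?_
      filter_upwards [eventually_gt_atTop 0] with h hh
      exact (hD_pos h hh x hx').symm
  have hint : Integrable fun x => V x - (Set.Iic 0).indicator 1 x := by
    refine hKint.mono' (hVm.sub (measurable_one.indicator measurableSet_Iic)).aestronglyMeasurable ?_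
    filter_upwards [hne] with x hx
    refine le_of_tendsto (hptw x hx).norm ?_
    filter_upwards [hbound] with h hb using hb x hx
  have hconv : Tendsto (fun h => ∫ x, D h x) atTop
      (𝓝 (∫ x, (V x - (Set.Iic 0).indicator 1 x))) := by
    refine tendsto_integral_filter_of_dominated_convergence _
      (Eventually.of_forall fun h => (hDm h).aestronglyMeasurable) ?_ hKint ?_
    · filter_upwards [hbound] with h hb
      filter_upwards [hne] with x hx using hb x hx
    · filter_upwards [hne] with x hx using hptw x hx
  refine ⟨hint, fun h => (∫ x, D h x) - ∫ x, (V x - (Set.Iic 0).indicator 1 x), ?_, ?_⟩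
  · simpa using hconv.sub_const (∫ x, (V x - (Set.Iic 0).indicator 1 x))
  filter_upwards [hbound, eventually_gt_atTop 0] with h hb hh
  have hs : 0 < √h := Real.sqrt_pos.2 hh
  have hDint : Integrable (D h) := by
    refine hKint.mono' (hDm h).aestronglyMeasurable ?_
    filter_upwards [hne] with x hx using hb x hx
  have hfint : Integrable (f h) := by
    have h1 : Integrable fun x => f h (h + x) := by
      refine (integrable_comp_mul_right_iff (fun x => f h (h + x)) hs.ne').1 hDint
    simpa using h1.comp_sub_left (0 : ℝ) |>.comp_neg.comp_sub_right h
  have hfval : ∫ t, f h t = √h * ∫ x, D h x := by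
    have h1 := Measure.integral_comp_mul_right (fun x => f h (h + x)) √h
    rw [integral_add_left_eq_self (f h) h, abs_of_pos (inv_pos.2 hs), smul_eq_mul] at h1
    rw [show ∫ x, D h x = (√h)⁻¹ * ∫ t, f h t from h1, mul_inv_cancel_left₀ hs.ne']
  have hone : Integrable ((Set.Ioc 0 h).indicator (1 : ℝ → ℝ)) :=
    (integrableOn_const (by simp)).integrable_indicator measurableSet_Ioc
  have hsum : (Set.Ioi 0).indicator (fun t : ℝ => B h ⌊t⌋₊) =
      fun t => f h t + (Set.Ioc 0 h).indicator 1 t := by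
    ext t; simp [f]
  have hBint : Integrable ((Set.Ioi 0).indicator fun t : ℝ => B h ⌊t⌋₊) := by
    rw [hsum]; exact hfint.add hone
  have hBval : ∫ t in Set.Ioi (0 : ℝ), B h ⌊t⌋₊ = √h * (∫ x, D h x) + h := by
    rw [← integral_indicator measurableSet_Ioi, hsum, integral_add hfint hone, hfval,
      integral_indicator measurableSet_Ioc]
    simp [hh.le]
  rw [tsum_eq_lintegral_floor fun n => ENNReal.ofReal (B h n), ← ofReal_integral_eq_lintegral_ofReal
    ((integrable_indicator_iff measurableSet_Ioi).1 hBint) (Eventually.of_forall fun t => hB0 _ _),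
    hBval]
  congr 1
  ring

/-! ### Means of first hitting times -/

section FirstTime

/-- The first time at which the event `A t` occurs. -/
noncomputable def firstTime {Ω : Type*} (A : ℕ → Set Ω) (ω : Ω) : ℕ∞ :=
  ⨅ (t : ℕ) (_ : ω ∈ A t), (t : ℕ∞)

lemma lt_firstTime_iff {Ω : Type*} (A : ℕ → Set Ω) (ω : Ω) (n : ℕ) :
    (n : ℕ∞) < firstTime A ω ↔ ∀ t ≤ n, ω ∉ A t := by
  rw [← not_iff_not]
  push Not
  rw [firstTime]
  constructor
  · intro h
    by_contra hcon
    push Not at hcon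
    have : ((n + 1 : ℕ) : ℕ∞) ≤ ⨅ (t : ℕ) (_ : ω ∈ A t), (t : ℕ∞) := by
      refine le_iInf₂ fun t ht => ?_
      by_contra hlt
      have : t < n + 1 := by exact_mod_cast not_le.1 hlt
      exact hcon t (by omega) ht
    have h2 : ((n + 1 : ℕ) : ℕ∞) ≤ n := this.trans h
    have : n + 1 ≤ n := by exact_mod_cast h2
    omega
  · rintro ⟨t, ht, hA⟩
    exact (iInf₂_le t hA).trans (by exact_mod_cast ht)

lemma toENNReal_eq_tsum (a : ℕ∞) : (a : ℝ≥0∞) = ∑' n : ℕ, if (n : ℕ∞) < a then 1 else 0 := by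
  induction a using ENat.recTopCoe with
  | top => simp
  | coe k =>
    rw [tsum_eq_sum (s := Finset.range k) fun n hn => by simpa using hn]
    rw [Finset.sum_congr rfl fun n hn => if_pos (by simpa using hn)]
    simp

lemma lintegral_firstTime {Ω : Type*} [MeasurableSpace Ω] {P : Measure Ω} {A : ℕ → Set Ω}
    (hA : ∀ t, MeasurableSet (A t)) :
    ∫⁻ ω, (firstTime A ω : ℝ≥0∞) ∂P = ∑' n : ℕ, P {ω | ∀ t ≤ n, ω ∉ A t} := by
  have hm (n : ℕ) : MeasurableSet {ω | ∀ t ≤ n, ω ∉ A t} := by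
    have e : {ω | ∀ t ≤ n, ω ∉ A t} = ⋂ t, ⋂ (_ : t ≤ n), (A t)ᶜ := by ext; simp
    rw [e]
    exact MeasurableSet.iInter fun t => MeasurableSet.iInter fun _ => (hA t).compl
  have e (ω : Ω) : (firstTime A ω : ℝ≥0∞) =
      ∑' n : ℕ, {ω | ∀ t ≤ n, ω ∉ A t}.indicator 1 ω := by
    rw [toENNReal_eq_tsum]
    refine tsum_congr fun n => ?_
    by_cases h : ∀ t ≤ n, ω ∉ A t
    · rw [if_pos ((lt_firstTime_iff A ω n).2 h), Set.indicator_of_mem (by exact h), Pi.one_apply]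
    · rw [if_neg (mt (lt_firstTime_iff A ω n).1 h), Set.indicator_of_notMem (by exact h)]
  simp_rw [e]
  rw [lintegral_tsum fun n => (measurable_one.indicator (hm n)).aemeasurable]
  exact tsum_congr fun n => lintegral_indicator_one (hm n)

end FirstTime

/-! ### Alarm and vote probabilities in a network -/

/-- A finite family of independent random walks with positive drift. -/
structure IsDriftNetwork {Ω ι : Type*} [MeasurableSpace Ω] (P : Measure Ω) (Z : ℕ × ι → Ω → ℝ)
    (m v : ι → ℝ) : Prop where
  indep : iIndepFun Z P
  walk : ∀ s, IsDriftWalk P (fun n => Z (n, s)) (m s) (v s)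

/-- At time `n`, the running maxima of at least `M` CUSUM statistics exceed their thresholds. -/
def alarmSet {Ω ι : Type*} (Z : ℕ × ι → Ω → ℝ) (m : ι → ℝ) (M : ℕ) (h : ℝ) (n : ℕ) : Set Ω :=
  {ω | M ≤ {s | m s * h < partialSups (cusum fun i => Z (i, s) ω) n}.ncard}

/-- At time `n`, at least `M` CUSUM statistics exceed their thresholds. -/
def voteSet {Ω ι : Type*} (Z : ℕ × ι → Ω → ℝ) (m : ι → ℝ) (M : ℕ) (h : ℝ) (n : ℕ) : Set Ω :=
  {ω | M ≤ {s | m s * h < cusum (fun i => Z (i, s) ω) n}.ncard}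

lemma exists_not_of_ncard_lt {ι : Type*} [Fintype ι] {M : ℕ} (hM : M ≤ Fintype.card ι)
    {p : ι → Prop} (h : ¬ M ≤ {s | p s}.ncard) : ∃ s, ¬ p s := by
  rw [le_ncard_setOf_iff] at h
  by_contra hcon
  push Not at hcon
  exact h ⟨Finset.univ, by simpa using hM, fun i _ => hcon i⟩

lemma exists_of_le_ncard {ι : Type*} [Fintype ι] {M : ℕ} (hM : 1 ≤ M)
    {p : ι → Prop} (h : M ≤ {s | p s}.ncard) : ∃ s, p s := by
  obtain ⟨T, hT, hp⟩ := (le_ncard_setOf_iff _ _).1 h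
  obtain ⟨i, hi⟩ := Finset.card_pos.1 (hM.trans hT)
  exact ⟨i, hp i hi⟩

lemma voteSet_subset_alarmSet {Ω ι : Type*} [Finite ι] {Z : ℕ × ι → Ω → ℝ} {m : ι → ℝ} {M : ℕ}
    (h : ℝ) (n : ℕ) : voteSet Z m M h n ⊆ alarmSet Z m M h n := fun ω hω =>
  le_trans hω (Set.ncard_le_ncard fun s (hs : m s * h < _) => hs.trans_le
    (le_partialSups (cusum fun i => Z (i, s) ω) n))

lemma alarmSet_mono {Ω ι : Type*} [Finite ι] {Z : ℕ × ι → Ω → ℝ} {m : ι → ℝ} {M : ℕ}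
    (h : ℝ) : Monotone (alarmSet Z m M h) := fun a b hab ω hω =>
  le_trans hω (Set.ncard_le_ncard fun s (hs : m s * h < _) => hs.trans_le
    (partialSups_monotone (cusum fun i => Z (i, s) ω) hab))

namespace IsDriftNetwork

variable {Ω ι : Type*} [MeasurableSpace Ω] {P : Measure Ω}
  [Fintype ι] {Z : ℕ × ι → Ω → ℝ} {m v : ι → ℝ} {M : ℕ}

lemma measurableSet_alarmSet (hZ : IsDriftNetwork P Z m v) (h : ℝ) (n : ℕ) :
    MeasurableSet (alarmSet Z m M h n) :=
  measurableSet_le_ncard M (A := fun s => {ω | m s * h < partialSups (cusum fun i => Z (i, s) ω) n})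
    fun s => measurableSet_lt measurable_const ((hZ.walk s).measurable_partialSups_cusum_comp n)

lemma measurableSet_voteSet (hZ : IsDriftNetwork P Z m v) (h : ℝ) (n : ℕ) :
    MeasurableSet (voteSet Z m M h n) :=
  measurableSet_le_ncard M (A := fun s => {ω | m s * h < cusum (fun i => Z (i, s) ω) n})
    fun s => measurableSet_lt measurable_const ((hZ.walk s).measurable_cusum_comp n)

lemma prob_alarmSet [DecidableEq ι] (hZ : IsDriftNetwork P Z m v) (h : ℝ) (n : ℕ) :
    P.real (alarmSet Z m M h n) = countProb M fun s =>
      P.real {ω | m s * h < partialSups (cusum fun i => Z (i, s) ω) n} :=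
  prob_le_ncard (iIndepFun_rows hZ.indep fun p => (hZ.walk p.2).measurable p.1)
    (fun _ => measurable_pi_lambda _ (hZ.walk _).measurable)
    (B := fun s => {z | m s * h < partialSups (cusum z) n})
    (fun _ => measurableSet_lt measurable_const (measurable_partialSups_cusum n)) M

lemma prob_voteSet [DecidableEq ι] (hZ : IsDriftNetwork P Z m v) (h : ℝ) (n : ℕ) :
    P.real (voteSet Z m M h n) = countProb M fun s =>
      P.real {ω | m s * h < cusum (fun i => Z (i, s) ω) n} :=
  prob_le_ncard (iIndepFun_rows hZ.indep fun p => (hZ.walk p.2).measurable p.1)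
    (fun _ => measurable_pi_lambda _ (hZ.walk _).measurable)
    (B := fun s => {z | m s * h < cusum z n})
    (fun _ => measurableSet_lt measurable_const (measurable_cusum n)) M

variable [IsProbabilityMeasure P]

lemma prob_alarmSet_le (hZ : IsDriftNetwork P Z m v) (hM : 1 ≤ M) {h : ℝ} {n : ℕ} (hn : n < h) :
    P.real (alarmSet Z m M h n) ≤ 4 * (∑ s, v s / m s ^ 2) * (n / (h - n) ^ 2) := by
  calc P.real (alarmSet Z m M h n)
      ≤ P.real (⋃ s, {ω | m s * h < partialSups (cusum fun i => Z (i, s) ω) n}) :=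
        measureReal_mono fun ω hω => Set.mem_iUnion.2 (exists_of_le_ncard hM hω)
    _ ≤ ∑ s, P.real {ω | m s * h < partialSups (cusum fun i => Z (i, s) ω) n} :=
        measureReal_iUnion_fintype_le _
    _ ≤ ∑ s, 4 * (n * v s / (m s * (h - n)) ^ 2) :=
        Finset.sum_le_sum fun s _ => (hZ.walk s).prob_lt_partialSups_cusum n hn
    _ = _ := by
        rw [Finset.mul_sum, Finset.sum_mul]
        exact Finset.sum_congr rfl fun s _ => by rw [mul_pow, div_mul_eq_div_div]; ring

lemma prob_exists_block_le (hZ : IsDriftNetwork P Z m v) (k : ℕ) {h : ℝ} {n : ℕ} (hn : h < n) :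
    P.real {ω | ∃ s, ∑ i ∈ Finset.range (k + n), Z (i, s) ω - ∑ i ∈ Finset.range k, Z (i, s) ω ≤
      m s * h} ≤ (∑ s, v s / m s ^ 2) * (n / (n - h) ^ 2) := by
  calc _ ≤ P.real (⋃ s, {ω | ∑ i ∈ Finset.range (k + n), Z (i, s) ω -
          ∑ i ∈ Finset.range k, Z (i, s) ω ≤ m s * h}) :=
        measureReal_mono fun ω hω => Set.mem_iUnion.2 hω
    _ ≤ ∑ s, P.real {ω | ∑ i ∈ Finset.range (k + n), Z (i, s) ω -
          ∑ i ∈ Finset.range k, Z (i, s) ω ≤ m s * h} := measureReal_iUnion_fintype_le _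
    _ ≤ ∑ s, n * v s / (m s * (n - h)) ^ 2 :=
        Finset.sum_le_sum fun s _ => (hZ.walk s).prob_block_sum_le k n hn
    _ = _ := by
        rw [Finset.sum_mul]
        exact Finset.sum_congr rfl fun s _ => by rw [mul_pow, div_mul_eq_div_div]; ring

lemma prob_compl_voteSet_le (hZ : IsDriftNetwork P Z m v) (hM : M ≤ Fintype.card ι) {h : ℝ}
    {n : ℕ} (hn : h < n) :
    P.real (voteSet Z m M h n)ᶜ ≤ (∑ s, v s / m s ^ 2) * (n / (n - h) ^ 2) := by
  refine le_trans (measureReal_mono fun ω hω => ?_) (hZ.prob_exists_block_le 0 hn)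
  obtain ⟨s, hs⟩ := exists_not_of_ncard_lt hM hω
  refine ⟨s, ?_⟩
  simpa using (sum_le_cusum _ _).trans (not_lt.1 hs)

/-- No vote at the ends of two consecutive blocks forces two independent unlikely events. -/
lemma prob_forall_notMem_voteSet_le (hZ : IsDriftNetwork P Z m v) (hM : M ≤ Fintype.card ι) {h : ℝ}
    {k : ℕ} (hk0 : 0 < k) (hk : h < k) :
    P.real {ω | ∀ t ≤ k + k, ω ∉ voteSet Z m M h t} ≤
      ((∑ s, v s / m s ^ 2) * (k / (k - h) ^ 2)) ^ 2 := by
  classical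
  -- `F` sees only the times before `k` and `G` only those in `[k, 2k)`, over all sensors, so the
  -- two events are independent.
  let F : (ℕ × ι → ℝ) → Prop := fun y => ∃ s, ∑ i ∈ Finset.range k, y (i, s) ≤ m s * h
  let G : (ℕ × ι → ℝ) → Prop := fun y => ∃ s, ∑ i ∈ Finset.Ico k (k + k), y (i, s) ≤ m s * h
  have hms (I : Finset ℕ) :
      Measurable fun y : ℕ × ι → ℝ => ∃ s, ∑ i ∈ I, y (i, s) ≤ m s * h := by
    refine measurableSet_setOfPred.1 ?_
    have e : {y : ℕ × ι → ℝ | ∃ s, ∑ i ∈ I, y (i, s) ≤ m s * h} =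
        ⋃ s, {y | ∑ i ∈ I, y (i, s) ≤ m s * h} := by ext; simp
    rw [e]
    exact MeasurableSet.iUnion fun s => measurableSet_le
      (Finset.measurable_sum _ fun i _ => measurable_pi_apply _) measurable_const
  have hdisj : Disjoint (Finset.range k ×ˢ (Finset.univ : Finset ι))
      (Finset.Ico k (k + k) ×ˢ Finset.univ) := by
    refine Finset.disjoint_product.2 (Or.inl ?_)
    rw [Finset.range_eq_Ico]; exact Finset.Ico_disjoint_Ico_consecutive 0 k _
  have hi := indepFun_of_disjoint hZ.indep (fun p => (hZ.walk p.2).measurable p.1) hdisj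
    (F := F) (G := G) (hms _) (hms _)
  have hmul := hi.measure_inter_preimage_eq_mul {True} {True} (measurableSet_singleton _)
    (measurableSet_singleton _)
  have e1 : (fun ω => F fun i => if i ∈ Finset.range k ×ˢ (Finset.univ : Finset ι) then Z i ω
      else 0) ⁻¹' {True} = {ω | ∃ s, ∑ i ∈ Finset.range (0 + k), Z (i, s) ω -
        ∑ i ∈ Finset.range 0, Z (i, s) ω ≤ m s * h} := by
    ext ω
    simp only [Set.mem_preimage, Set.mem_singleton_iff, eq_iff_iff, iff_true, F,
      Set.mem_ofPred_eq, zero_add, Finset.range_zero, Finset.sum_empty, sub_zero]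
    refine exists_congr fun s => ?_
    rw [Finset.sum_congr rfl fun i hi => if_pos (by simpa using hi)]
  have e2 : (fun ω => G fun i => if i ∈ Finset.Ico k (k + k) ×ˢ (Finset.univ : Finset ι) then Z i ω
      else 0) ⁻¹' {True} = {ω | ∃ s, ∑ i ∈ Finset.range (k + k), Z (i, s) ω -
        ∑ i ∈ Finset.range k, Z (i, s) ω ≤ m s * h} := by
    ext ω
    simp only [Set.mem_preimage, Set.mem_singleton_iff, eq_iff_iff, iff_true, G,
      Set.mem_ofPred_eq]
    refine exists_congr fun s => ?_
    rw [Finset.sum_congr rfl fun i hi => if_pos (by simpa using hi),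
      Finset.sum_Ico_eq_sub _ (Nat.le_add_right k k)]
  rw [e1, e2] at hmul
  have hmul' := congrArg ENNReal.toReal hmul
  rw [ENNReal.toReal_mul] at hmul'
  refine le_trans (measureReal_mono (fun ω hω => ?_)) (hmul'.trans_le ?_)
  · refine ⟨?_, ?_⟩
    · obtain ⟨s, hs⟩ := exists_not_of_ncard_lt hM (hω k (by omega))
      refine ⟨s, ?_⟩
      simpa using (sum_le_cusum _ _).trans (not_lt.1 hs)
    -- The CUSUM statistic at time `2k` dominates the walk restarted at `k`, so the first block
    -- plays no role here.
    · obtain ⟨s, hs⟩ := exists_not_of_ncard_lt hM (hω (k + k) le_rfl)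
      exact ⟨s, (sum_sub_sum_le_cusum _ (by omega)).trans (not_lt.1 hs)⟩
  · rw [sq]
    exact mul_le_mul (hZ.prob_exists_block_le 0 hk) (hZ.prob_exists_block_le k hk)
      measureReal_nonneg (le_trans measureReal_nonneg (hZ.prob_exists_block_le k hk))

end IsDriftNetwork

/-! ### Inverse-square tails and the expansions of the two means -/

namespace IsDriftNetwork

variable {Ω ι : Type*} [MeasurableSpace Ω] {P : Measure Ω} [Fintype ι] {Z : ℕ × ι → Ω → ℝ} {m v : ι → ℝ} {M : ℕ}

lemma sum_nonneg (hZ : IsDriftNetwork P Z m v) : 0 ≤ ∑ s, v s / m s ^ 2 :=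
  Finset.sum_nonneg fun s _ => div_nonneg (hZ.walk s).variance_nonneg' (sq_nonneg _)

variable [IsProbabilityMeasure P]

/-- Here `n ≤ h` and `h - n ≥ |x| √h`, so `n / (h - n)² ≤ 1 / x²`. -/
lemma prob_early_alarm_le (hZ : IsDriftNetwork P Z m v) (hM : 1 ≤ M) {h x : ℝ} (hh : 0 < h)
    (hx : x < 0) (hx' : -√h < x) :
    P.real (alarmSet Z m M h ⌊h + x * √h⌋₊) ≤ 4 * (∑ s, v s / m s ^ 2) / x ^ 2 := by
  set Q := ∑ s, v s / m s ^ 2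
  have hQ : 0 ≤ Q := hZ.sum_nonneg
  have hs : 0 < √h := Real.sqrt_pos.2 hh
  have h1 := Real.mul_self_sqrt hh.le
  have h2 : x * √h < 0 := mul_neg_of_neg_of_pos hx hs
  have h3 : -√h * √h < x * √h := by gcongr
  have hn : (⌊h + x * √h⌋₊ : ℝ) ≤ h + x * √h := Nat.floor_le (by linarith)
  refine (hZ.prob_alarmSet_le hM (n := ⌊h + x * √h⌋₊) (by linarith)).trans ?_
  set n : ℝ := (⌊h + x * √h⌋₊ : ℝ)
  change 4 * Q * _ ≤ _
  rw [mul_div_assoc, mul_assoc]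
  have hxx : (-x * √h) ^ 2 = x ^ 2 * h := by rw [mul_pow, neg_sq, sq √h, h1]
  have key : n / (h - n) ^ 2 ≤ 1 / x ^ 2 := by
    calc n / (h - n) ^ 2 ≤ h / (-x * √h) ^ 2 := by
          have : 0 < -x * √h := by linarith
          gcongr <;> linarith
      _ = 1 / x ^ 2 := by rw [hxx]; field_simp
  calc 4 * (Q * (n / (h - n) ^ 2)) ≤ 4 * (Q * (1 / x ^ 2)) := by gcongr
    _ = 4 * (Q / x ^ 2) := by ring

lemma prob_late_compl_voteSet_le (hZ : IsDriftNetwork P Z m v) (hM : M ≤ Fintype.card ι)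
    {h x : ℝ} (hh : 4 ≤ h) (hx : 0 < x) (hle : (⌊h + x * √h⌋₊ : ℝ) ≤ 4 * h) :
    P.real (voteSet Z m M h ⌊h + x * √h⌋₊)ᶜ ≤ (1 + 16 * ∑ s, v s / m s ^ 2) / x ^ 2 := by
  set Q := ∑ s, v s / m s ^ 2
  have hQ : 0 ≤ Q := hZ.sum_nonneg
  have hs : 2 ≤ √h := Real.le_sqrt_of_sq_le (by linarith)
  have h1 := Real.mul_self_sqrt (by linarith : 0 ≤ h)
  have h2 : 0 < x * √h := by positivity
  have hn := Nat.lt_floor_add_one (h + x * √h)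
  -- Rounding may cost 1. If `x √h ≤ 2` then `x ≤ 1` and the trivial bound suffices, whence the
  -- summand 1 in the constant. Otherwise `n - h ≥ x √h / 2`, and `n ≤ 4h` gives `16 / x²`.
  rcases le_total (x * √h) 2 with hsm | hbig
  · have hx1 : x ≤ 1 := by nlinarith
    refine measureReal_le_one.trans ?_
    rw [le_div_iff₀ (by positivity)]
    nlinarith
  · refine (hZ.prob_compl_voteSet_le hM (n := ⌊h + x * √h⌋₊) (by linarith)).trans ?_
    set n : ℝ := (⌊h + x * √h⌋₊ : ℝ)
    have hxx : (x * √h / 2) ^ 2 = x ^ 2 * h / 4 := by rw [div_pow, mul_pow, sq √h, h1]; norm_num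
    have key : n / (n - h) ^ 2 ≤ 16 / x ^ 2 := by
      calc n / (n - h) ^ 2 ≤ (4 * h) / (x * √h / 2) ^ 2 := by
            gcongr
            linarith
        _ = 16 / x ^ 2 := by rw [hxx]; field_simp; norm_num
    calc Q * (n / (n - h) ^ 2) ≤ Q * (16 / x ^ 2) := by gcongr
      _ = 16 * Q / x ^ 2 := by ring
      _ ≤ (1 + 16 * Q) / x ^ 2 := by gcongr; linarith

/-- Two blocks of length `⌊n/2⌋` give a bound of order `1 / n²`, and `x ≤ n`. -/
lemma prob_very_late_vote_le (hZ : IsDriftNetwork P Z m v) (hM : M ≤ Fintype.card ι)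
    {h x : ℝ} (hh : 4 ≤ h) (hx : 0 < x) (hlt : 4 * h < ⌊h + x * √h⌋₊) :
    P.real {ω | ∀ t ≤ ⌊h + x * √h⌋₊, ω ∉ voteSet Z m M h t} ≤
      169 * (∑ s, v s / m s ^ 2) ^ 2 / x ^ 2 := by
  set Q := ∑ s, v s / m s ^ 2
  have hQ : 0 ≤ Q := hZ.sum_nonneg
  have hs : 2 ≤ √h := Real.le_sqrt_of_sq_le (by linarith)
  have hn := Nat.lt_floor_add_one (h + x * √h)
  have hxs : x * 2 ≤ x * √h := by gcongr
  set n : ℕ := ⌊h + x * √h⌋₊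
  obtain ⟨k, hk⟩ : ∃ k, k = n / 2 := ⟨_, rfl⟩
  have hk1 : k + k ≤ n := by omega
  have hk2 : (n : ℝ) ≤ k + k + 1 := by exact_mod_cast (by omega : n ≤ k + k + 1)
  have hk1' : (k : ℝ) + k ≤ n := by exact_mod_cast hk1
  -- `k ≥ (n - 1) / 2` and `h < n / 4` leave `n / 4 - 1 / 2`, which exceeds `n / 5` because `n >
  -- 16`.
  have hkh : (n : ℝ) / 5 ≤ k - h := by linarith
  have hnpos : (0 : ℝ) < n := by linarith
  have hk0 : 0 < k := by
    have : (0 : ℝ) < k := by linarith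
    exact_mod_cast this
  have hxn : x ≤ n := by linarith
  have key : (k : ℝ) / (k - h) ^ 2 ≤ 13 / (n : ℝ) := by
    calc (k : ℝ) / (k - h) ^ 2 ≤ ((n : ℝ) / 2) / ((n : ℝ) / 5) ^ 2 := by gcongr; linarith
      _ = (25 / 2) / (n : ℝ) := by field_simp; norm_num
      _ ≤ 13 / (n : ℝ) := by gcongr; norm_num
  have hnonneg : 0 ≤ (k : ℝ) / (k - h) ^ 2 := by positivity
  calc P.real {ω | ∀ t ≤ n, ω ∉ voteSet Z m M h t}
      ≤ P.real {ω | ∀ t ≤ k + k, ω ∉ voteSet Z m M h t} :=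
        measureReal_mono fun ω hω t ht => hω t (ht.trans hk1)
    _ ≤ (Q * (k / (k - h) ^ 2)) ^ 2 :=
        hZ.prob_forall_notMem_voteSet_le hM hk0 (by linarith)
    _ ≤ (Q * (13 / x)) ^ 2 := by
        have : (k : ℝ) / (k - h) ^ 2 ≤ 13 / x := key.trans (by gcongr)
        gcongr
    _ = 169 * Q ^ 2 / x ^ 2 := by ring

/-- Both sides are `1 - countProb` of single-coordinate probabilities, so continuity of the
polynomial reduces the limit to one sensor. -/
lemma tendsto_prob_compl_alarmSet (hZ : IsDriftNetwork P Z m v) (hM : 1 ≤ M)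
    (hM' : M ≤ Fintype.card ι) {x : ℝ} (hx : x ≠ 0) :
    Tendsto (fun h => P.real (alarmSet Z m M h ⌊h + x * √h⌋₊)ᶜ) atTop
      (𝓝 ((Measure.pi fun s => gaussianReal 0 ((v s).toNNReal / (m s).toNNReal ^ 2)).real
        {y | x < orderStat M y})) := by
  classical
  rw [prob_lt_orderStat hM hM']
  have h1 (h : ℝ) : P.real (alarmSet Z m M h ⌊h + x * √h⌋₊)ᶜ =
      1 - countProb M fun s => P.real
        {ω | m s * h < partialSups (cusum fun i => Z (i, s) ω) ⌊h + x * √h⌋₊} := by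
    rw [probReal_compl_eq_one_sub (hZ.measurableSet_alarmSet h _), hZ.prob_alarmSet]
  simp_rw [h1]
  refine tendsto_const_nhds.sub (((continuous_countProb M).tendsto _).comp
    (tendsto_pi_nhds.2 fun s => ?_))
  exact (hZ.walk s).tendsto_prob_lt (hZ.walk s).measurable_partialSups_cusum_comp
    (fun n ω => (sum_le_cusum _ n).trans (le_partialSups _ n)) (fun n ω => le_rfl) hx

lemma tendsto_prob_compl_voteSet (hZ : IsDriftNetwork P Z m v) (hM : 1 ≤ M)
    (hM' : M ≤ Fintype.card ι) {x : ℝ} (hx : x ≠ 0) :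
    Tendsto (fun h => P.real (voteSet Z m M h ⌊h + x * √h⌋₊)ᶜ) atTop
      (𝓝 ((Measure.pi fun s => gaussianReal 0 ((v s).toNNReal / (m s).toNNReal ^ 2)).real
        {y | x < orderStat M y})) := by
  classical
  rw [prob_lt_orderStat hM hM']
  have h1 (h : ℝ) : P.real (voteSet Z m M h ⌊h + x * √h⌋₊)ᶜ =
      1 - countProb M fun s => P.real
        {ω | m s * h < cusum (fun i => Z (i, s) ω) ⌊h + x * √h⌋₊} := by
    rw [probReal_compl_eq_one_sub (hZ.measurableSet_voteSet h _), hZ.prob_voteSet]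
  simp_rw [h1]
  refine tendsto_const_nhds.sub (((continuous_countProb M).tendsto _).comp
    (tendsto_pi_nhds.2 fun s => ?_))
  exact (hZ.walk s).tendsto_prob_lt (hZ.walk s).measurable_cusum_comp
    (fun n ω => sum_le_cusum _ n) (fun n ω => le_partialSups _ n) hx

/-- The expansion of a sum of survival probabilities, with the mean of the Gaussian order
statistic as second-order coefficient. -/
lemma tsum_expansion_orderStat (hM : 1 ≤ M) (hM' : M ≤ Fintype.card ι) (w : ι → ℝ≥0)
    {B : ℝ → ℕ → ℝ} (hB0 : ∀ h n, 0 ≤ B h n) (hB1 : ∀ h n, B h n ≤ 1) (C : ℝ)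
    (hpos : ∀ᶠ h in atTop, ∀ x, 0 < x → B h ⌊h + x * √h⌋₊ ≤ C / x ^ 2)
    (hneg : ∀ᶠ h in atTop, ∀ x, x < 0 → -√h < x → 1 - B h ⌊h + x * √h⌋₊ ≤ C / x ^ 2)
    (hlim : ∀ x, x ≠ 0 → Tendsto (fun h => B h ⌊h + x * √h⌋₊) atTop
      (𝓝 ((Measure.pi fun s => gaussianReal 0 (w s)).real {y | x < orderStat M y}))) :
    ∃ δ : ℝ → ℝ, Tendsto δ atTop (𝓝 0) ∧ ∀ᶠ h in atTop,
      ∑' n, ENNReal.ofReal (B h n) = ENNReal.ofReal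
        (h + ((∫ y, orderStat M y ∂(Measure.pi fun s => gaussianReal 0 (w s))) + δ h) * √h) := by
  set μ := Measure.pi fun s => gaussianReal 0 (w s)
  have hanti : Antitone fun x : ℝ => μ.real {y | x < orderStat M y} :=
    fun a b hab => measureReal_mono fun y hy => lt_of_le_of_lt hab hy
  obtain ⟨hint, hmain⟩ := tsum_expansion hanti.measurable hB0 hB1 C hpos hneg hlim
  rwa [integral_eq_integral_tail (measurable_orderStat hM hM')
    (integrable_orderStat hM hM' _ fun s => (memLp_id_gaussianReal 1).integrable le_rfl) hint]

theorem lintegral_alarm_expansion (hZ : IsDriftNetwork P Z m v) (hM : 1 ≤ M)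
    (hM' : M ≤ Fintype.card ι) :
    ∃ δ : ℝ → ℝ, Tendsto δ atTop (𝓝 0) ∧ ∀ᶠ h in atTop,
      ∫⁻ ω, (firstTime (alarmSet Z m M h) ω : ℝ≥0∞) ∂P = ENNReal.ofReal
        (h + ((∫ y, orderStat M y ∂(Measure.pi fun s =>
          gaussianReal 0 ((v s).toNNReal / (m s).toNNReal ^ 2))) + δ h) * √h) := by
  set Q := ∑ s, v s / m s ^ 2 with hQdef
  have hQ : 0 ≤ Q := hZ.sum_nonneg
  refine Exists.imp (fun δ hδ => ⟨hδ.1, hδ.2.mono fun h hh => ?_⟩) (tsum_expansion_orderStat hM hM'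
    (fun s => (v s).toNNReal / (m s).toNNReal ^ 2)
    (B := fun h n => P.real (alarmSet Z m M h n)ᶜ) (fun _ _ => measureReal_nonneg)
    -- One constant for all three regimes: `1 + 16 Q` for times up to `4h`, `169 Q²` beyond, and the
    -- early bound `4 Q` is absorbed.
    (fun _ _ => measureReal_le_one) (1 + 16 * Q + 169 * Q ^ 2) ?_ ?_
    (fun x hx => hZ.tendsto_prob_compl_alarmSet hM hM' hx))
  · rw [← hh, lintegral_firstTime (hZ.measurableSet_alarmSet h)]
    refine tsum_congr fun n => ?_
    rw [ofReal_measureReal]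
    congr 1
    ext ω
    -- Running maxima increase, so no alarm up to `n` is the same as no alarm at `n`; this is the
    -- source of equality.
    exact ⟨fun hω => hω n le_rfl, fun hω t ht hcon => hω (alarmSet_mono h ht hcon)⟩
  · filter_upwards [eventually_ge_atTop 4] with h hh x hx
    rcases le_or_gt (⌊h + x * √h⌋₊ : ℝ) (4 * h) with hn | hn
    · refine (measureReal_mono (Set.compl_subset_compl.2 (voteSet_subset_alarmSet h _))).trans
        ((hZ.prob_late_compl_voteSet_le hM' hh hx hn).trans ?_)
      exact div_le_div_of_nonneg_right (by nlinarith) (sq_nonneg x)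
    · refine (measureReal_mono fun ω hω t ht hcon => ?_).trans
        ((hZ.prob_very_late_vote_le hM' hh hx hn).trans ?_)
      · exact hω (alarmSet_mono h ht (voteSet_subset_alarmSet h _ hcon))
      · gcongr
        rw [← hQdef]
        linarith
  · filter_upwards [eventually_gt_atTop 0] with h hh x hx hx'
    rw [probReal_compl_eq_one_sub (hZ.measurableSet_alarmSet h _), sub_sub_cancel]
    refine (hZ.prob_early_alarm_le hM hh hx hx').trans ?_
    gcongr
    rw [← hQdef]
    nlinarith

theorem lintegral_vote_expansion_le (hZ : IsDriftNetwork P Z m v) (hM : 1 ≤ M)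
    (hM' : M ≤ Fintype.card ι) :
    ∃ δ : ℝ → ℝ, Tendsto δ atTop (𝓝 0) ∧ ∀ᶠ h in atTop,
      ∫⁻ ω, (firstTime (voteSet Z m M h) ω : ℝ≥0∞) ∂P ≤ ENNReal.ofReal
        (h + ((∫ y, orderStat M y ∂(Measure.pi fun s =>
          gaussianReal 0 ((v s).toNNReal / (m s).toNNReal ^ 2))) + δ h) * √h) := by
  set Q := ∑ s, v s / m s ^ 2 with hQdef
  have hQ : 0 ≤ Q := hZ.sum_nonneg
  -- Survival is bounded by the absence of a vote at time `n`, whose limit is known. The available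
  -- bound on that decays only like `1 / n` for large `n`, which is not summable, so the true
  -- survival probability is kept beyond `4h`.
  let B : ℝ → ℕ → ℝ := fun h n => if (n : ℝ) ≤ 4 * h then P.real (voteSet Z m M h n)ᶜ
    else P.real {ω | ∀ t ≤ n, ω ∉ voteSet Z m M h t}
  refine Exists.imp (fun δ hδ => ⟨hδ.1, hδ.2.mono fun h hh => ?_⟩) (tsum_expansion_orderStat hM hM'
    (fun s => (v s).toNNReal / (m s).toNNReal ^ 2) (B := B)
    (fun h n => by simp only [B]; split_ifs <;> exact measureReal_nonneg)
    (fun h n => by simp only [B]; split_ifs <;> exact measureReal_le_one)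
    (1 + 16 * Q + 169 * Q ^ 2) ?_ ?_ ?_)
  · rw [← hh, lintegral_firstTime (hZ.measurableSet_voteSet h)]
    refine ENNReal.tsum_le_tsum fun n => ?_
    simp only [B]
    split_ifs
    · rw [ofReal_measureReal]
      exact measure_mono fun ω hω => hω n le_rfl
    · rw [ofReal_measureReal]
  · filter_upwards [eventually_ge_atTop 4] with h hh x hx
    simp only [B]
    split_ifs with hn
    · refine (hZ.prob_late_compl_voteSet_le hM' hh hx hn).trans ?_
      exact div_le_div_of_nonneg_right (by nlinarith) (sq_nonneg x)
    · refine (hZ.prob_very_late_vote_le hM' hh hx (not_le.1 hn)).trans ?_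
      gcongr
      rw [← hQdef]
      linarith
  · filter_upwards [eventually_gt_atTop 0] with h hh x hx hx'
    have hs : 0 < √h := Real.sqrt_pos.2 hh
    have h2 : x * √h < 0 := mul_neg_of_neg_of_pos hx hs
    have hle : (⌊h + x * √h⌋₊ : ℝ) ≤ 4 * h := by
      have := Nat.floor_le_floor (by linarith : h + x * √h ≤ h)
      have h3 : (⌊h + x * √h⌋₊ : ℝ) ≤ ⌊h⌋₊ := by exact_mod_cast this
      linarith [Nat.floor_le hh.le]
    simp only [B, if_pos hle]
    rw [probReal_compl_eq_one_sub (hZ.measurableSet_voteSet h _), sub_sub_cancel]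
    refine (measureReal_mono (voteSet_subset_alarmSet h _)).trans
      ((hZ.prob_early_alarm_le hM hh hx hx').trans ?_)
    gcongr
    rw [← hQdef]
    nlinarith
  · intro x hx
    refine (hZ.tendsto_prob_compl_voteSet hM hM' hx).congr' ?_
    -- For fixed `x` the time is asymptotic to `h`, hence eventually below `4h`, and only the first
    -- branch of `B` matters in the limit.
    filter_upwards [(tendsto_floor_div_self x).eventually_le_const (by norm_num : (1 : ℝ) < 4),
      eventually_gt_atTop 0] with h h1 hh
    simp only [B, if_pos ((div_le_iff₀ hh).1 h1)]

end IsDriftNetwork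

/-! ### Log-likelihood ratios as a network of walks -/

lemma isDriftNetwork_llr {L : ℕ} {N : Fin L → ℕ} {Ω : Type*} [MeasurableSpace Ω]
    {P₀ : Measure Ω} [IsProbabilityMeasure P₀]
    {E : Fin L → Type*} [∀ l, MeasurableSpace (E l)] {f g : (l : Fin L) → Measure (E l)}
    [∀ l, IsProbabilityMeasure (f l)] [∀ l, IsProbabilityMeasure (g l)]
    {X : ℕ → (s : Sensor N) → Ω → E s.1} (hX : IsChangeModel f g 0 P₀ X)
    (hI_pos : ∀ l, 0 < klDiv (g l) (f l)) (hI_fin : ∀ l, klDiv (g l) (f l) < ⊤)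
    (hσ : ∀ l, llrVar (f l) (g l) < ⊤) :
    IsDriftNetwork P₀ (fun (p : ℕ × Sensor N) ω => llr (g p.2.1) (f p.2.1) (X p.1 p.2 ω))
      (fun s => info (f s.1) (g s.1)) (fun s => (llrVar (f s.1) (g s.1)).toReal) := by
  have hind : iIndepFun (fun (p : ℕ × Sensor N) ω => llr (g p.2.1) (f p.2.1) (X p.1 p.2 ω)) P₀ :=
    hX.indep.comp (fun p => llr (g p.2.1) (f p.2.1)) fun p => measurable_llr _ _
  refine ⟨hind, fun s => ?_⟩
  have hac : g s.1 ≪ f s.1 := (klDiv_ne_top_iff.1 (hI_fin s.1).ne).1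
  have hlaw (n : ℕ) : P₀.map (X n s) = g s.1 := hX.law_post n s (by simp)
  -- For probability measures the mass correction in `klDiv` vanishes, so the divergence is the mean
  -- log-likelihood ratio.
  have hmean : ∫ x, llr (g s.1) (f s.1) x ∂(g s.1) = info (f s.1) (g s.1) :=
    (toReal_klDiv_of_measure_eq hac (by simp)).symm
  have hvar : llrVar (f s.1) (g s.1) = eVar[llr (g s.1) (f s.1); g s.1] := by
    rw [evariance_eq_lintegral_ofReal, hmean, llrVar]
  have hL2 : MemLp (llr (g s.1) (f s.1)) 2 (g s.1) :=
    (evariance_lt_top_iff_memLp (measurable_llr _ _).aestronglyMeasurable).1 (hvar ▸ hσ s.1)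
  have hmp : MeasurePreserving (X 0 s) P₀ (g s.1) := ⟨hX.measurable 0 s, hlaw 0⟩
  exact {
    measurable := fun n => (measurable_llr _ _).comp (hX.measurable n s)
    indep := hind.precomp (g := fun n : ℕ => (n, s)) fun a b h => by simpa using h
    ident := fun n => IdentDistrib.comp (u := llr (g s.1) (f s.1))
      ⟨(hX.measurable n s).aemeasurable, (hX.measurable 0 s).aemeasurable, by
        rw [hlaw, hlaw]⟩ (measurable_llr _ _)
    memLp := hL2.comp_measurePreserving hmp
    mean := by
      rw [← hmean, ← hlaw 0, integral_map (hX.measurable 0 s).aemeasurable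
        (measurable_llr _ _).aestronglyMeasurable]
    variance := by
      rw [hvar]
      exact hmp.variance_fun_comp (measurable_llr _ _).aemeasurable
    drift_pos := ENNReal.toReal_pos (hI_pos s.1).ne' (hI_fin s.1).ne }

end HetQCD

theorem theorem2 {L : ℕ} (N : Fin L → ℕ) {Ω : Type*} [MeasurableSpace Ω]
    (P₀ : Measure Ω) [IsProbabilityMeasure P₀]
    {E : Fin L → Type*} [∀ l, MeasurableSpace (E l)] (f g : (l : Fin L) → Measure (E l))
    [∀ l, IsProbabilityMeasure (f l)] [∀ l, IsProbabilityMeasure (g l)]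
    (X : ℕ → (s : HetQCD.Sensor N) → Ω → E s.1)
    (hX : HetQCD.IsChangeModel f g 0 P₀ X)
    (hI_pos : ∀ l, 0 < klDiv (g l) (f l)) (hI_fin : ∀ l, klDiv (g l) (f l) < ⊤)
    (hσ : ∀ l, HetQCD.llrVar (f l) (g l) < ⊤)
    (M : ℕ) (hM_pos : 1 ≤ M) (hM_le : M ≤ ∑ l, N l) :
    (∃ δ : ℝ → ℝ, Tendsto δ atTop (𝓝 0) ∧ ∀ᶠ h in atTop,
      ∫⁻ ω, (HetQCD.alarmTime f g X M (fun l => HetQCD.info (f l) (g l) * h) ω : ℝ≥0∞) ∂P₀ =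
        ENNReal.ofReal (h + (HetQCD.xi N f g M + δ h) * √h)) ∧
    (∃ δ : ℝ → ℝ, Tendsto δ atTop (𝓝 0) ∧ ∀ᶠ h in atTop,
      ∫⁻ ω, (HetQCD.votingTime f g X M (fun l => HetQCD.info (f l) (g l) * h) ω : ℝ≥0∞) ∂P₀ ≤
        ENNReal.ofReal (h + (HetQCD.xi N f g M + δ h) * √h)) := by
  have hZ := HetQCD.isDriftNetwork_llr hX hI_pos hI_fin hσ
  have hcard : M ≤ Fintype.card (HetQCD.Sensor N) := by simpa using hM_le
  have hxi : HetQCD.xi N f g M = ∫ y, HetQCD.orderStat M y ∂(Measure.pi fun s : HetQCD.Sensor N =>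
      gaussianReal 0 ((HetQCD.llrVar (f s.1) (g s.1)).toReal.toNNReal /
        (HetQCD.info (f s.1) (g s.1)).toNNReal ^ 2)) := by
    simp only [HetQCD.xi, ENNReal.toNNReal_toReal_eq]
  rw [hxi]
  exact ⟨hZ.lintegral_alarm_expansion hM_pos hcard, hZ.lintegral_vote_expansion_le hM_pos hcard⟩
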